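/- Let $H\in(1/2,1)$, $\sigma_H>0$, and let $(W^H_t)_{t\in\mathbb R}$ be a fractional Brownian motion with Hurst index $H$: a zero-mean Gaussian process with almost surely continuous paths and covariance $$\mathbb E[W^H_tW^H_s]=\frac{\sigma_H^2}{2}\big(|t|^{2H}+|s|^{2H}-|t-s|^{2H}\big).$$ For $\varepsilon>0$ let $$Z^\varepsilon_t=\varepsilon^{-H}\int_{-\infty}^t e^{-(t-s)/\varepsilon}\,dW^H_s=\varepsilon^{-H}W^H_t-\varepsilon^{-1-H}\int_{-\infty}^te^{-(t-s)/\varepsilon}W^H_s\,ds$$ be the $\varepsilon$-scaled fractional Ornstein–Uhlenbeck process, and let $\sigma^\varepsilon_t=F(Z^\varepsilon_t)$, where $F:\mathbb R\to\mathbb R$ is one-to-one, positive, smooth, and bounded with bounded derivatives of all orders. Put $\sigma_{\rm ou}^2=\tfrac12\Gamma(2H+1)\sigma_H^2$, $\sigma_{\rm ou}>0$ (so that $\sigma_{\rm ou}^2=1/(2\sin(\pi H))$ for the normalization $\sigma_H^2=1/(\Gamma(2H+1)\sin(\pi H))$), and, for $j=1,2$, $$\langle F^j\rangle=\int_{\mathbb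 R}F(\sigma_{\rm ou}z)^jp(z)\,dz,\qquad \langle F'^j\rangle=\int_{\mathbb R}F'(\sigma_{\rm ou}z)^jp(z)\,dz,$$ with $p$ the density of the standard normal distribution. Then $\langle F^2\rangle-\langle F\rangle^2>0$, and: 1. For every $\varepsilon>0$, $(\sigma^\varepsilon_t)_{t\in\mathbb R}$ is a (strictly) stationary, square-integrable process with $\mathbb E[\sigma^\varepsilon_t]=\langle F\rangle$ and $\mathrm{Var}(\sigma^\varepsilon_t)=\langle F^2\rangle-\langle F\rangle^2$, both independent of $\varepsilon$. 2. There is a function $\mathcal C_\sigma:\mathbb R\to\mathbb R$, depending only on $H$, $\sigma_H$ and $F$, such that for all $\varepsilon>0$ and $t,s\in\mathbb R$ $$\mathrm{Cov}(\sigma^\varepsilon_t,\sigma^\varepsilon_{t+s})=\big(\langle F^2\rangle-\langle F\rangle^2\big)\,\mathcal C_\sigma(s/\varepsilon),$$ with $\mathcal C_\sigma(0)=1$ and $$\mathcal C_\sigma(s)=\frac{1}{\Gamma(2H-1)}\,\frac{\sigma_{\rm ou}^2\langle F'\rangle^2}{\langle F^2\rangle-\langle F\rangle^2}\,s^{2H-2}+o\big(s^{2H-2}\big)\quad\text{as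 } s\to\infty.$$ Consequently, for every $\varepsilon>0$, the process $\sigma^\varepsilon$ has long-range correlations: for every $t$, the correlation coefficient of $\sigma^\varepsilon_t$ and $\sigma^\varepsilon_{t+s}$ is, as a function of $s$, not integrable at infinity. -/

import Mathlib

open MeasureTheory ProbabilityTheory Filter Asymptotics

namespace FOU

/-- `W` is a fractional Brownian motion on the real line with Hurst index `H` and scale `σH`:
a zero-mean Gaussian process with (almost surely) continuous paths and covariance
`E[W_t W_s] = (σH² / 2) (|t|^{2H} + |s|^{2H} - |t - s|^{2H})`. -/
structure IsFBM {Ω : Type*} [MeasurableSpace Ω] (P : Measure Ω) (H σH : ℝ)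
    (W : ℝ → Ω → ℝ) : Prop where
  gaussian : IsGaussianProcess W P
  mean_zero : ∀ t, ∫ ω, W t ω ∂P = 0
  cov : ∀ t s, ∫ ω, W t ω * W s ω ∂P
    = σH ^ 2 / 2 * (|t| ^ (2 * H) + |s| ^ (2 * H) - |t - s| ^ (2 * H))
  continuous_paths : ∀ᵐ ω ∂P, Continuous fun t => W t ω

/-- The `ε`-scaled fractional Ornstein-Uhlenbeck process driven by `W`,
`Z_t = ε^{-H} W_t - ε^{-1-H} ∫_{-∞}^t e^{-(t-s)/ε} W_s ds`, that is, the pathwise meaning (by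
integration by parts) of `ε^{-H} ∫_{-∞}^t e^{-(t-s)/ε} dW_s`. -/
noncomputable def fOU {Ω : Type*} (H ε : ℝ) (W : ℝ → Ω → ℝ) (t : ℝ) (ω : Ω) : ℝ :=
  ε ^ (-H) * W t ω
    - ε ^ (-1 - H) * ∫ s in Set.Iic t, Real.exp (-(t - s) / ε) * W s ω

/-- The volatility process `σ_t = F (Z_t)`. -/
noncomputable def vol {Ω : Type*} (H ε : ℝ) (F : ℝ → ℝ) (W : ℝ → Ω → ℝ) (t : ℝ) (ω : Ω) : ℝ :=
  F (fOU H ε W t ω)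

/-- `σ_ou`, the positive root of `σ_ou² = Γ(2H+1) σH² / 2`. -/
noncomputable def sigmaOU (H σH : ℝ) : ℝ :=
  Real.sqrt (1 / 2 * Real.Gamma (2 * H + 1) * σH ^ 2)

/-- `⟨G^j⟩ = ∫ G(s z)^j p(z) dz`, with `p` the density of the standard normal distribution. -/
noncomputable def avg (s : ℝ) (G : ℝ → ℝ) (j : ℕ) : ℝ :=
  ∫ z, G (s * z) ^ j * gaussianPDFReal 0 1 z

/-- One-to-one, positive, smooth, bounded, with bounded derivatives of every order
(boundedness of `F` itself is the case `n = 0`). -/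
structure IsVolFunction (F : ℝ → ℝ) : Prop where
  injective : Function.Injective F
  pos : ∀ x, 0 < F x
  smooth : ContDiff ℝ (⊤ : ℕ∞) F
  bounded : ∀ n : ℕ, ∃ C : ℝ, ∀ x, |iteratedDeriv n F x| ≤ C

/-- (Strict) stationarity: finite-dimensional distributions are invariant under time shifts. -/
def IsStationary {Ω : Type*} [MeasurableSpace Ω] (X : ℝ → Ω → ℝ) (P : Measure Ω) : Prop :=
  ∀ (h : ℝ) (I : Finset ℝ),
    IdentDistrib (fun ω (i : I) => X (i + h) ω) (fun ω (i : I) => X i ω) P P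

/-- Long-range correlations: for every `t`, the correlation coefficient of `X_t` and `X_{t+s}`
is not integrable in `s` at infinity. -/
def HasLongRangeCorrelations {Ω : Type*} [MeasurableSpace Ω] (X : ℝ → Ω → ℝ)
    (P : Measure Ω) : Prop :=
  ∀ t a : ℝ, ∫⁻ s in Set.Ioi a,
    ENNReal.ofReal |cov[X t, X (t + s); P] / Real.sqrt (Var[X t; P] * Var[X (t + s); P])| = ⊤

end FOU

/-! Substituting `s = t - ε u` turns the moving average into a mean over a standard exponential
variable `U`: `Z_t = ε^(-H) E_U[W_t - W_{t - εU}]`. The covariance of `Z` is then an average of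
covariances of fBM increments over independent exponentials `U`, `V`. The term in `U - V` simplifies
because `U - V` is Laplace distributed, an equal mixture of `U` and `-U`
(`integral_integral_sub_stdExp`). By self-similarity the result is a function `fouCov` of `(t' - t)
/ ε`. Up to a constant it averages a second difference of `|·|^(2H)`, hence behaves like `H (2H - 1)
σH² τ^(2H-2)` (`tendsto_rpow_mul_fouCov`).

`Z` is Gaussian because it lies in the closed `L²` span of `W` (`toLp_fOU_mem_closure`) and the
centered Gaussian form of the characteristic function survives `L²` limits. All finite-dimensional
laws are thus determined by `fouCov`, which gives stationarity and the explicit law of pairs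
(`IsFBM.identDistrib_pair`).

The covariance of `F(Z_t)` and `F(Z_{t'})` is therefore `pairMean F s ρ - pairMean F s 0`, with `ρ`
the correlation of the pair. The derivative of `pairMean` at `ρ = 0` is `s² ⟨F'⟩²` by Gaussian
integration by parts, so the decay of `ρ` carries over to the volatility. Injectivity makes `F`
strictly monotone, hence `⟨F'⟩ ≠ 0`; the leading constant is positive, and since `2H - 2 > -1` the
correlation is not integrable. -/

namespace FOU

/-! ### Exponential averages and the Laplace distribution -/

section

open Set Topology

/-- The standard exponential distribution. -/
noncomputable def stdExp : Measure ℝ :=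
  (volume.restrict (Ioi 0)).withDensity fun u => ENNReal.ofReal (Real.exp (-u))

lemma integral_stdExp {E : Type*} [NormedAddCommGroup E] [NormedSpace ℝ E] (f : ℝ → E) :
    ∫ u, f u ∂stdExp = ∫ u in Ioi 0, Real.exp (-u) • f u := by
  rw [stdExp, integral_withDensity_eq_integral_toReal_smul (by fun_prop) (by simp)]
  simp [Real.exp_nonneg]

lemma integrable_stdExp_iff {E : Type*} [NormedAddCommGroup E] [NormedSpace ℝ E] {f : ℝ → E} :
    Integrable f stdExp ↔ IntegrableOn (fun u => Real.exp (-u) • f u) (Ioi 0) := by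
  rw [stdExp, integrable_withDensity_iff_integrable_smul' (by fun_prop) (by simp)]
  simp [Real.exp_nonneg, IntegrableOn]

instance : IsProbabilityMeasure stdExp := by
  constructor
  rw [stdExp, withDensity_apply _ MeasurableSet.univ, Measure.restrict_univ,
    ← ofReal_integral_eq_lintegral_ofReal]
  · rw [integral_exp_neg_Ioi_zero, ENNReal.ofReal_one]
  · exact integrableOn_exp_neg_Ioi 0
  · exact ae_of_all _ fun u => (Real.exp_pos _).le

lemma ae_pos_stdExp : ∀ᵐ u ∂stdExp, 0 < u :=
  (withDensity_absolutelyContinuous _ _).ae_le (ae_restrict_mem measurableSet_Ioi)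

lemma integrable_rpow_stdExp {p : ℝ} (hp : -1 < p) : Integrable (fun u => u ^ p) stdExp := by
  rw [integrable_stdExp_iff]
  simpa using Real.GammaIntegral_convergent (s := p + 1) (by linarith)

lemma integral_rpow_stdExp {p : ℝ} (hp : -1 < p) :
    ∫ u, u ^ p ∂stdExp = Real.Gamma (p + 1) := by
  rw [integral_stdExp, Real.Gamma_eq_integral (by linarith)]
  simp

lemma abs_rpow_le_one_add_sq {p : ℝ} (hp : 0 ≤ p) (hp2 : p ≤ 2) (x : ℝ) :
    |x| ^ p ≤ 1 + x ^ 2 := by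
  rcases le_total |x| 1 with h | h
  · have := Real.rpow_le_one (abs_nonneg x) h hp
    nlinarith [sq_nonneg x]
  · have := Real.rpow_le_rpow_of_exponent_le h hp2
    rw [Real.rpow_two, sq_abs] at this
    linarith

lemma integrable_sq_stdExp : Integrable (fun u => u ^ 2) stdExp := by
  simpa using integrable_rpow_stdExp (p := 2) (by norm_num)

lemma integrable_stdExp_of_le_sq {f : ℝ → ℝ} (hf : Measurable f) (a b : ℝ)
    (h : ∀ u, |f u| ≤ a + b * u ^ 2) : Integrable f stdExp :=
  ((integrable_const a).add (integrable_sq_stdExp.const_mul b)).mono' hf.aestronglyMeasurable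
    (ae_of_all _ h)

lemma measurable_abs_rpow (p : ℝ) : Measurable fun x : ℝ => |x| ^ p :=
  Measurable.pow_const (by fun_prop) _

lemma integrable_abs_add_mul_rpow {p : ℝ} (hp : 0 ≤ p) (hp2 : p ≤ 2) (a b : ℝ) :
    Integrable (fun u => |a + b * u| ^ p) stdExp := by
  refine integrable_stdExp_of_le_sq ((measurable_abs_rpow p).comp (by fun_prop))
    (1 + 2 * a ^ 2) (2 * b ^ 2) fun u => ?_
  rw [abs_of_nonneg (by positivity)]
  refine (abs_rpow_le_one_add_sq hp hp2 _).trans ?_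
  nlinarith [sq_nonneg (a - b * u)]

lemma charFun_stdExp (t : ℝ) : charFun stdExp t = 1 / (1 - t * Complex.I) := by
  have h : (-(1 - t * Complex.I)).re < 0 := by simp
  rw [charFun_apply_real, integral_stdExp]
  have := integral_exp_mul_complex_Ioi h 0
  simp only [Complex.ofReal_zero, mul_zero, Complex.exp_zero, neg_div_neg_eq] at this
  rw [← this]
  congr 1
  ext u
  rw [Complex.real_smul, Complex.ofReal_exp, ← Complex.exp_add]
  congr 1
  push_cast
  ring

/-- Partial fractions for characteristic functions: `1 / ((1 - it)(1 + it))` is the mean of `1 / (1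
- it)` and `1 / (1 + it)`. -/
lemma map_neg_stdExp_conv :
    stdExp ∗ stdExp.map (fun u => -1 * u)
      = (2⁻¹ : NNReal) • (stdExp + stdExp.map (fun u => -1 * u)) := by
  have : IsProbabilityMeasure (stdExp.map fun u : ℝ => -1 * u) :=
    Measure.isProbabilityMeasure_map (by fun_prop)
  apply Measure.ext_of_charFun
  ext t
  rw [charFun_conv, charFun_map_mul, charFun_apply (μ := _ • _), integral_smul_nnreal_measure,
    integral_add_measure, ← charFun_apply, ← charFun_apply, charFun_map_mul, charFun_stdExp,
    charFun_stdExp]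
  · have h1 : (1 - t * Complex.I) ≠ 0 := fun h => by simpa using congrArg Complex.re h
    have h2 : (1 + t * Complex.I) ≠ 0 := fun h => by simpa using congrArg Complex.re h
    rw [NNReal.smul_def, Complex.real_smul]
    push_cast
    rw [show (1 - -1 * (t : ℂ) * Complex.I) = 1 + t * Complex.I by ring]
    field_simp
    ring
  all_goals
    refine (integrable_const (1 : ℝ)).mono' (by fun_prop) (ae_of_all _ fun u => ?_)
    rw [Complex.norm_exp_ofReal_mul_I]

lemma integrable_map_neg_conv {f : ℝ → ℝ} (hf : Measurable f) (h1 : Integrable f stdExp)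
    (h2 : Integrable (fun u => f (-u)) stdExp) :
    Integrable f (stdExp ∗ stdExp.map (fun u => -1 * u)) := by
  rw [map_neg_stdExp_conv]
  refine Integrable.smul_measure_nnreal (h1.add_measure ?_)
  rw [integrable_map_measure hf.aestronglyMeasurable (by fun_prop)]
  simpa [Function.comp_def] using h2

/-- The difference of two independent standard exponential variables has the standard Laplace
distribution. -/
lemma integral_integral_sub_stdExp {f : ℝ → ℝ} (hf : Measurable f) (h1 : Integrable f stdExp)
    (h2 : Integrable (fun u => f (-u)) stdExp) :
    ∫ u, ∫ v, f (u - v) ∂stdExp ∂stdExp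
      = 2⁻¹ * (∫ u, f u ∂stdExp + ∫ u, f (-u) ∂stdExp) := by
  have h := integral_conv (integrable_map_neg_conv hf h1 h2)
  have e : ∀ u : ℝ, ∫ v, f (u + v) ∂(stdExp.map fun u => -1 * u) = ∫ v, f (u - v) ∂stdExp := by
    intro u
    rw [integral_map (f := fun v => f (u + v)) (by fun_prop)
      (hf.comp (by fun_prop)).aestronglyMeasurable]
    simp [sub_eq_add_neg]
  simp_rw [e] at h
  rw [← h, map_neg_stdExp_conv, integral_smul_nnreal_measure, integral_add_measure h1,
    integral_map (by fun_prop) hf.aestronglyMeasurable, NNReal.smul_def]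
  · simp
  · rw [integrable_map_measure hf.aestronglyMeasurable (by fun_prop)]
    simpa [Function.comp_def] using h2

/-! ### The covariance function `fouCov` -/

/-- The covariance function of the fractional Ornstein-Uhlenbeck process at unit scale. -/
noncomputable def fouCov (H σH τ : ℝ) : ℝ :=
  σH ^ 2 / 2 * (2⁻¹ * (∫ u, |τ + u| ^ (2 * H) ∂stdExp + ∫ u, |τ - u| ^ (2 * H) ∂stdExp)
    - |τ| ^ (2 * H))

lemma sigmaOU_sq {H : ℝ} (hH : 0 < H) (σH : ℝ) :
    sigmaOU H σH ^ 2 = 1 / 2 * Real.Gamma (2 * H + 1) * σH ^ 2 := by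
  have := Real.Gamma_pos_of_pos (s := 2 * H + 1) (by linarith)
  rw [sigmaOU, Real.sq_sqrt (by positivity)]

lemma sigmaOU_pos {H σH : ℝ} (hH : 0 < H) (hσ : 0 < σH) : 0 < sigmaOU H σH := by
  have := Real.Gamma_pos_of_pos (s := 2 * H + 1) (by linarith)
  exact Real.sqrt_pos.2 (by positivity)

lemma fouCov_zero {H : ℝ} (hH : 0 < H) (σH : ℝ) : fouCov H σH 0 = sigmaOU H σH ^ 2 := by
  have h : ∫ u, |u| ^ (2 * H) ∂stdExp = Real.Gamma (2 * H + 1) := by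
    rw [← integral_rpow_stdExp (by linarith)]
    refine integral_congr_ae ?_
    filter_upwards [ae_pos_stdExp] with u hu
    rw [abs_of_pos hu]
  simp only [fouCov, zero_add, zero_sub, abs_neg, h, abs_zero]
  rw [Real.zero_rpow (by linarith), sigmaOU_sq hH]
  ring

lemma integrable_abs_add_rpow {H : ℝ} (hH : 0 < H) (hH1 : H < 1) (τ : ℝ) :
    Integrable (fun u => |τ + u| ^ (2 * H)) stdExp := by
  simpa using integrable_abs_add_mul_rpow (p := 2 * H) (by linarith) (by linarith) τ 1

lemma integrable_abs_sub_rpow {H : ℝ} (hH : 0 < H) (hH1 : H < 1) (τ : ℝ) :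
    Integrable (fun u => |τ - u| ^ (2 * H)) stdExp := by
  simpa [sub_eq_add_neg] using
    integrable_abs_add_mul_rpow (p := 2 * H) (by linarith) (by linarith) τ (-1)

lemma integral_add_const_sub_const_sub {α : Type*} [MeasurableSpace α] {μ : Measure α}
    [IsProbabilityMeasure μ] {f g : α → ℝ} (hf : Integrable f μ) (hg : Integrable g μ) (c d : ℝ) :
    ∫ x, (f x + c - d - g x) ∂μ = ∫ x, f x ∂μ + c - d - ∫ x, g x ∂μ := by
  have h : Integrable (fun x => f x - g x) μ := hf.sub hg
  rw [show (fun x => f x + c - d - g x) = fun x => f x - g x + (c - d) by ext x; ring,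
    integral_add h (integrable_const _), integral_sub hf hg]
  simp
  ring

/-- The integrand is the covariance of two fBM increments after scaling out `ε`. The Laplace
identity makes the mean of the last term half the sum of the means of the first two, which leaves
exactly `fouCov`. -/
lemma integral_integral_increment_cov {H : ℝ} (hH : 0 < H) (hH1 : H < 1) (σH τ : ℝ) :
    ∫ u, ∫ v, σH ^ 2 / 2 * (|τ - v| ^ (2 * H) + |τ + u| ^ (2 * H) - |τ| ^ (2 * H)
      - |τ + u - v| ^ (2 * H)) ∂stdExp ∂stdExp = fouCov H σH τ := by
  have hi : ∀ u, ∫ v, σH ^ 2 / 2 * (|τ - v| ^ (2 * H) + |τ + u| ^ (2 * H) - |τ| ^ (2 * H)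
      - |τ + u - v| ^ (2 * H)) ∂stdExp
      = σH ^ 2 / 2 * (∫ v, |τ - v| ^ (2 * H) ∂stdExp + |τ + u| ^ (2 * H) - |τ| ^ (2 * H)
        - ∫ v, |τ + u - v| ^ (2 * H) ∂stdExp) := by
    intro u
    have h1 := integrable_abs_sub_rpow hH hH1 τ
    have h2 := integrable_abs_sub_rpow hH hH1 (τ + u)
    rw [integral_const_mul, integral_add_const_sub_const_sub h1 h2]
  have hm : Measurable fun x : ℝ => |τ + x| ^ (2 * H) :=
    (measurable_abs_rpow _).comp (by fun_prop)
  have hA := integrable_abs_add_rpow hH hH1 τ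
  have hS := integrable_abs_sub_rpow hH hH1 τ
  have hS' : Integrable (fun u => |τ + -u| ^ (2 * H)) stdExp := by
    simpa [sub_eq_add_neg] using hS
  have key := integral_integral_sub_stdExp hm hA hS'
  -- Integrability under the law of `u - v` is pulled back to the product measure, and one variable
  -- is then integrated out.
  have hI : Integrable (fun u => ∫ v, |τ + u - v| ^ (2 * H) ∂stdExp) stdExp := by
    have h := integrable_map_neg_conv hm hA hS'
    have hp : Integrable (fun q : ℝ × ℝ => |τ + (q.1 - q.2)| ^ (2 * H)) (stdExp.prod stdExp) := by
      rw [Measure.conv, integrable_map_measure hm.aestronglyMeasurable (by fun_prop)] at h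
      have e : stdExp.prod (stdExp.map fun u => -1 * u)
          = (stdExp.prod stdExp).map (fun q : ℝ × ℝ => (q.1, -1 * q.2)) := by
        have := Measure.map_prod_map stdExp stdExp (f := id) (g := fun u : ℝ => -1 * u)
          measurable_id (by fun_prop)
        rw [Measure.map_id] at this
        exact this
      rw [e, integrable_map_measure (by
        exact ((hm.comp (by fun_prop : Measurable fun q : ℝ × ℝ => q.1 + q.2))).aestronglyMeasurable)
        (by fun_prop)] at h
      simpa [Function.comp_def, sub_eq_add_neg] using h
    simpa [add_sub_assoc] using hp.integral_prod_left
  simp_rw [hi]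
  simp_rw [add_comm (∫ v, |τ - v| ^ (2 * H) ∂stdExp) (|τ + _| ^ (2 * H))]
  rw [integral_const_mul, integral_add_const_sub_const_sub hA hI]
  simp_rw [add_sub_assoc, key, fouCov, sub_eq_add_neg]
  ring

/-! ### Power-law decay of `fouCov` -/

/-- The symmetric second difference of `|·|^p` at `1`. -/
noncomputable def secondDiff (p x : ℝ) : ℝ := |1 + x| ^ p + |1 - x| ^ p - 2

lemma tendsto_secondDiff (p : ℝ) :
    Tendsto (fun x => secondDiff p x / x ^ 2) (𝓝[>] 0) (𝓝 (p * (p - 1))) := by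
  have hlt : ∀ᶠ x : ℝ in 𝓝[>] 0, x < 1 :=
    mem_nhdsWithin_of_mem_nhds (Iio_mem_nhds one_pos)
  have hpos : ∀ᶠ x : ℝ in 𝓝[>] 0, 0 < x := self_mem_nhdsWithin
  have hd : ∀ q x : ℝ, 0 < 1 + x → HasDerivAt (fun x : ℝ => (1 + x) ^ q) (q * (1 + x) ^ (q - 1)) x := by
    intro q x hx
    simpa using ((hasDerivAt_id x).const_add 1).rpow_const (p := q) (Or.inl hx.ne')
  have hd' : ∀ q x : ℝ, 0 < 1 - x →
      HasDerivAt (fun x : ℝ => (1 - x) ^ q) (-(q * (1 - x) ^ (q - 1))) x := by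
    intro q x hx
    simpa using ((hasDerivAt_id x).const_sub 1).rpow_const (p := q) (Or.inl hx.ne')
  have hmain : Tendsto (fun x : ℝ => ((1 + x) ^ p + (1 - x) ^ p - 2) / x ^ 2) (𝓝[>] 0)
      (𝓝 (p * (p - 1))) := by
    refine HasDerivAt.lhopital_zero_nhdsGT (g' := fun x => 2 * x)
      (f' := fun x => p * (1 + x) ^ (p - 1) + -(p * (1 - x) ^ (p - 1))) ?_ ?_ ?_ ?_ ?_ ?_
    · filter_upwards [hlt, hpos] with x h1 h0
      exact ((hd p x (by linarith)).add (hd' p x (by linarith))).sub_const 2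
    · exact Eventually.of_forall fun x => by simpa using hasDerivAt_pow 2 x
    · filter_upwards [hpos] with x h0
      positivity
    · have h : ContinuousAt (fun x : ℝ => (1 + x) ^ p + (1 - x) ^ p - 2) 0 :=
        (((hd p 0 (by norm_num)).add (hd' p 0 (by norm_num))).sub_const 2).continuousAt
      have := h.tendsto.mono_left (nhdsWithin_le_nhds (s := Ioi 0))
      norm_num at this
      exact this
    · have h : ContinuousAt (fun x : ℝ => x ^ 2) 0 := by fun_prop
      simpa using h.tendsto.mono_left (nhdsWithin_le_nhds (s := Ioi 0))
    · have h := (((hd (p - 1) 0 (by norm_num)).const_mul p).add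
        ((hd' (p - 1) 0 (by norm_num)).const_mul p).neg).tendsto_slope_zero_right
      have h2 := h.const_mul (1 / 2)
      simp only [add_zero, sub_zero, Real.one_rpow] at h2
      convert h2 using 2
      · simp [div_eq_mul_inv]
        ring
      · ring
  refine hmain.congr' ?_
  filter_upwards [hlt, hpos] with x h1 h0
  rw [secondDiff, abs_of_pos (by linarith), abs_of_pos (by linarith)]

/-- Provides the dominating function `C u²` for the limit of `fouCov`. Near `0` the bound comes from
the limit of the quotient; for `x ≥ δ` it comes from quadratic growth, where `6 + 2x²` is absorbed
using `1 ≤ x² / δ²`. -/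
lemma exists_abs_secondDiff_le {p : ℝ} (hp : 0 ≤ p) (hp2 : p ≤ 2) :
    ∃ C, ∀ x, 0 < x → |secondDiff p x| ≤ C * x ^ 2 := by
  have h := (tendsto_secondDiff p).abs.eventually_le_const
    (show |p * (p - 1)| < |p * (p - 1)| + 1 by linarith)
  obtain ⟨δ, hδ, hsub⟩ := mem_nhdsGT_iff_exists_Ioo_subset.1 h
  have hδ : 0 < δ := hδ
  refine ⟨max (|p * (p - 1)| + 1) (6 / δ ^ 2 + 2), fun x hx => ?_⟩
  rcases lt_or_ge x δ with hxδ | hxδ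
  · have h1 : |secondDiff p x / x ^ 2| ≤ |p * (p - 1)| + 1 := hsub ⟨hx, hxδ⟩
    rw [abs_div, abs_of_pos (by positivity : 0 < x ^ 2), div_le_iff₀ (by positivity)] at h1
    exact h1.trans (by gcongr; exact le_max_left _ _)
  · have h1 := abs_rpow_le_one_add_sq hp hp2 (1 + x)
    have h2 := abs_rpow_le_one_add_sq hp hp2 (1 - x)
    have h3 : 0 ≤ |1 + x| ^ p := by positivity
    have h4 : 0 ≤ |1 - x| ^ p := by positivity
    have h5 : 1 ≤ x ^ 2 / δ ^ 2 := by
      rw [le_div_iff₀ (by positivity)]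
      nlinarith
    calc |secondDiff p x| ≤ 6 + 2 * x ^ 2 := by
          rw [secondDiff, abs_le]
          constructor <;> nlinarith
      _ ≤ (6 / δ ^ 2 + 2) * x ^ 2 := by
          have : 6 / δ ^ 2 * x ^ 2 = 6 * (x ^ 2 / δ ^ 2) := by ring
          nlinarith
      _ ≤ _ := by gcongr; exact le_max_right _ _

lemma rpow_mul_fouCov {H : ℝ} (hH : 0 < H) (hH1 : H < 1) (σH : ℝ) {τ : ℝ} (hτ : 0 < τ) :
    τ ^ (2 - 2 * H) * fouCov H σH τ
      = σH ^ 2 / 4 * ∫ u, τ ^ 2 * secondDiff (2 * H) (u / τ) ∂stdExp := by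
  have hA := integrable_abs_add_rpow hH hH1 τ
  have hS := integrable_abs_sub_rpow hH hH1 τ
  have e : ∀ u, τ ^ 2 * secondDiff (2 * H) (u / τ)
      = τ ^ (2 - 2 * H) * (|τ + u| ^ (2 * H) + |τ - u| ^ (2 * H) - 2 * |τ| ^ (2 * H)) := by
    intro u
    have h1 : τ + u = τ * (1 + u / τ) := by field_simp
    have h2 : τ - u = τ * (1 - u / τ) := by field_simp
    have h3 : τ ^ 2 = τ ^ (2 - 2 * H) * τ ^ (2 * H) := by
      rw [← Real.rpow_add hτ, ← Real.rpow_two]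
      congr 1
      ring
    rw [h1, h2, abs_mul, abs_mul, Real.mul_rpow (abs_nonneg _) (abs_nonneg _),
      Real.mul_rpow (abs_nonneg _) (abs_nonneg _), abs_of_pos hτ, h3, secondDiff]
    ring
  simp_rw [e]
  have hAS : Integrable (fun u => |τ + u| ^ (2 * H) + |τ - u| ^ (2 * H)) stdExp := hA.add hS
  rw [integral_const_mul, integral_sub hAS (integrable_const _), integral_add hA hS, fouCov]
  simp
  ring

/-- Dominated convergence in the rescaled second difference. The constant is `σH² / 4 · 2H (2H - 1)
· E[U²]` with `E[U²] = 2`. -/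
lemma tendsto_rpow_mul_fouCov {H : ℝ} (hH : 0 < H) (hH1 : H < 1) (σH : ℝ) :
    Tendsto (fun τ => τ ^ (2 - 2 * H) * fouCov H σH τ) atTop
      (𝓝 (H * (2 * H - 1) * σH ^ 2)) := by
  obtain ⟨C, hC⟩ := exists_abs_secondDiff_le (p := 2 * H) (by linarith) (by linarith)
  have hlim : Tendsto (fun τ => ∫ u, τ ^ 2 * secondDiff (2 * H) (u / τ) ∂stdExp) atTop
      (𝓝 (∫ u, 2 * H * (2 * H - 1) * u ^ 2 ∂stdExp)) := by
    refine tendsto_integral_filter_of_dominated_convergence (fun u => C * u ^ 2) ?_ ?_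
      (integrable_sq_stdExp.const_mul C) ?_
    · refine Eventually.of_forall fun τ => Measurable.aestronglyMeasurable ?_
      have h1 : Measurable fun u : ℝ => |1 + u / τ| ^ (2 * H) :=
        (measurable_abs_rpow _).comp (by fun_prop)
      have h2 : Measurable fun u : ℝ => |1 - u / τ| ^ (2 * H) :=
        (measurable_abs_rpow _).comp (by fun_prop)
      exact ((h1.add h2).sub_const 2).const_mul _
    · filter_upwards [eventually_gt_atTop 0] with τ hτ
      filter_upwards [ae_pos_stdExp] with u hu
      have := hC (u / τ) (by positivity)
      rw [Real.norm_eq_abs, abs_mul, abs_of_pos (by positivity : 0 < τ ^ 2)]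
      calc τ ^ 2 * |secondDiff (2 * H) (u / τ)| ≤ τ ^ 2 * (C * (u / τ) ^ 2) := by gcongr
        _ = C * u ^ 2 := by field_simp
    · filter_upwards [ae_pos_stdExp] with u hu
      have hz : Tendsto (fun τ : ℝ => u / τ) atTop (𝓝[>] 0) := by
        refine tendsto_nhdsWithin_iff.2 ⟨tendsto_const_nhds.div_atTop tendsto_id, ?_⟩
        filter_upwards [eventually_gt_atTop 0] with τ hτ
        exact div_pos hu hτ
      refine (((tendsto_secondDiff (2 * H)).comp hz).mul_const (u ^ 2)).congr' ?_
      filter_upwards [eventually_gt_atTop 0] with τ hτ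
      simp only [Function.comp]
      field_simp
  have h2 : ∫ u, u ^ 2 ∂stdExp = 2 := by
    have := integral_rpow_stdExp (p := 2) (by norm_num)
    rw [show (2 : ℝ) + 1 = (2 : ℕ) + 1 by norm_num, Real.Gamma_nat_eq_factorial] at this
    simpa using this
  rw [integral_const_mul, h2] at hlim
  refine ((hlim.const_mul (σH ^ 2 / 4)).congr' ?_).trans (le_of_eq (by congr 1; ring))
  filter_upwards [eventually_gt_atTop 0] with τ hτ
  exact (rpow_mul_fouCov hH hH1 σH hτ).symm

/-! ### Gaussian averages of `F` and the pair functional -/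

section

/-- The standard normal distribution. -/
noncomputable abbrev stdNormal : Measure ℝ := gaussianReal 0 1

lemma avg_eq_integral (s : ℝ) (G : ℝ → ℝ) (j : ℕ) : avg s G j = ∫ z, G (s * z) ^ j ∂stdNormal := by
  rw [avg, integral_gaussianReal_eq_integral_smul one_ne_zero]
  simp [mul_comm]

namespace IsVolFunction

variable {F : ℝ → ℝ} (hF : IsVolFunction F)
include hF

lemma continuous : Continuous F := hF.smooth.continuous

lemma hasDerivAt (x : ℝ) : HasDerivAt F (deriv F x) x :=
  (hF.smooth.differentiable (by simp) x).hasDerivAt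

lemma continuous_deriv : Continuous (deriv F) := hF.smooth.continuous_deriv (by simp)

lemma exists_abs_le : ∃ C, ∀ x, |F x| ≤ C := by simpa using hF.bounded 0

lemma exists_abs_deriv_le : ∃ C, ∀ x, |deriv F x| ≤ C := by
  simpa [iteratedDeriv_one] using hF.bounded 1

lemma memLp_comp {Ω : Type*} [MeasurableSpace Ω] {P : Measure Ω} [IsFiniteMeasure P]
    {X : Ω → ℝ} (hX : AEMeasurable X P) : MemLp (fun ω => F (X ω)) 2 P := by
  obtain ⟨C, hC⟩ := hF.exists_abs_le
  exact MemLp.of_bound (hF.continuous.measurable.comp_aemeasurable hX).aestronglyMeasurable C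
    (ae_of_all _ fun ω => hC _)

lemma integrable_mul_comp (s : ℝ) : Integrable (fun z => z * F (s * z)) stdNormal := by
  obtain ⟨C, hC⟩ := hF.exists_abs_le
  have h : Integrable (fun z : ℝ => z) stdNormal := (memLp_id_gaussianReal 1).integrable le_rfl
  exact h.mul_bdd (c := C) (hF.continuous.measurable.comp (measurable_const_mul s)).aestronglyMeasurable
    (ae_of_all _ fun ω => hC _)

/-- Gaussian integration by parts: the standard normal density satisfies `p' = -z p`, and
boundedness of `F` and `F'` supplies integrability. -/
lemma integral_mul_comp (s : ℝ) :
    ∫ z, z * F (s * z) ∂stdNormal = s * avg s (deriv F) 1 := by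
  obtain ⟨C, hC⟩ := hF.exists_abs_le
  obtain ⟨C', hC'⟩ := hF.exists_abs_deriv_le
  have hm : AEStronglyMeasurable (fun z => F (s * z)) volume :=
    (hF.continuous.comp (by fun_prop)).aestronglyMeasurable
  have hm' : AEStronglyMeasurable (fun z => deriv F (s * z)) volume :=
    (hF.continuous_deriv.comp (by fun_prop)).aestronglyMeasurable
  have hp := integrable_gaussianPDFReal 0 1
  have hp' : Integrable (fun z => -(z * gaussianPDFReal 0 1 z)) := by
    have h := (integrable_mul_exp_neg_mul_sq (b := 1 / 2) (by norm_num)).const_mul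
      (-(√(2 * Real.pi * (1 : NNReal)))⁻¹)
    refine h.congr (ae_of_all _ fun z => ?_)
    simp only [gaussianPDFReal]
    rw [show -(z - 0) ^ 2 / (2 * ((1 : NNReal) : ℝ)) = -(1 / 2) * z ^ 2 by push_cast; ring]
    ring
  have hd : ∀ z, HasDerivAt (gaussianPDFReal 0 1) (-(z * gaussianPDFReal 0 1 z)) z := by
    intro z
    have h1 : HasDerivAt (fun z : ℝ => -(z - 0) ^ 2 / (2 * ((1 : NNReal) : ℝ))) (-z) z := by
      have := ((((hasDerivAt_id z).sub_const 0).pow 2).neg).div_const (2 * ((1 : NNReal) : ℝ))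
      refine this.congr_deriv ?_
      simp
      ring
    refine (h1.exp.const_mul ((√(2 * Real.pi * (1 : NNReal)))⁻¹)).congr_deriv ?_
    simp only [gaussianPDFReal]
    ring
  have hFd : ∀ z, HasDerivAt (fun z => F (s * z)) (deriv F (s * z) * s) z := by
    intro z
    exact ((hF.hasDerivAt (s * z)).comp z ((hasDerivAt_id z).const_mul s)).congr_deriv (by simp)
  have key := integral_mul_deriv_eq_deriv_mul_of_integrable
    (u := fun z => F (s * z)) (u' := fun z => deriv F (s * z) * s)
    (v := gaussianPDFReal 0 1) (v' := fun z => -(z * gaussianPDFReal 0 1 z))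
    (fun z _ => hFd z) (fun z _ => hd z)
    (hp'.bdd_mul (c := C) hm (ae_of_all _ fun z => hC _))
    (hp.bdd_mul (c := C' * |s|) (hm'.mul_const s) (ae_of_all _ fun z => by
      rw [Real.norm_eq_abs, abs_mul]
      exact mul_le_mul_of_nonneg_right (hC' _) (abs_nonneg _)))
    (hp.bdd_mul (c := C) hm (ae_of_all _ fun z => hC _))
  rw [integral_gaussianReal_eq_integral_smul one_ne_zero, avg, ← integral_const_mul]
  have h2 : ∀ z : ℝ, gaussianPDFReal 0 1 z • (z * F (s * z))
      = -(F (s * z) * -(z * gaussianPDFReal 0 1 z)) := fun z => by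
    rw [smul_eq_mul]
    ring
  simp_rw [h2]
  rw [integral_neg, key, neg_neg]
  refine integral_congr_ae (ae_of_all _ fun z => ?_)
  simp only [pow_one]
  ring

/-- Zero variance would make `F (s z)` almost surely constant, but by injectivity each level set has
at most one point, and the normal law has no atoms. -/
lemma variance_pos {s : ℝ} (hs : s ≠ 0) : 0 < avg s F 2 - avg s F 1 ^ 2 := by
  have hm : AEMeasurable (fun z : ℝ => s * z) stdNormal := by fun_prop
  have hL := hF.memLp_comp hm
  have hv : avg s F 2 - avg s F 1 ^ 2 = Var[fun z => F (s * z); stdNormal] := by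
    rw [variance_eq_sub hL, avg_eq_integral, avg_eq_integral]
    simp
  rw [hv]
  refine (variance_nonneg _ _).lt_of_ne' fun h => ?_
  have hae := ae_eq_integral_of_variance_eq_zero hL h
  have hnull : stdNormal {z | F (s * z) = ∫ z, F (s * z) ∂stdNormal} = 0 := by
    have : NullSingletonClass stdNormal := nullSingletonClass_gaussianReal one_ne_zero
    refine Set.Subsingleton.measure_zero (fun x hx y hy => ?_) _
    exact mul_left_cancel₀ hs (hF.injective (hx.trans hy.symm))
  have : ∀ᵐ z ∂stdNormal, False := by
    filter_upwards [hae, measure_eq_zero_iff_ae_notMem.1 hnull] with z h1 h2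
    exact h2 h1
  simp [IsProbabilityMeasure.ne_zero] at this

/-- Integration by parts turns `⟨F'⟩ = 0` into a vanishing mean of `z (F (s z) - F 0)`. A continuous
injective `F` is strictly monotone, so this product has constant sign and vanishes only at `z = 0`.
-/
lemma avg_deriv_ne_zero {s : ℝ} (hs : 0 < s) : avg s (deriv F) 1 ≠ 0 := by
  intro h0
  have hz : Integrable (fun z : ℝ => z) stdNormal := (memLp_id_gaussianReal 1).integrable le_rfl
  have hi : Integrable (fun z => z * (F (s * z) - F 0)) stdNormal := by
    simp_rw [mul_sub]
    exact (hF.integrable_mul_comp s).sub (hz.mul_const _)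
  have h : ∫ z, z * (F (s * z) - F 0) ∂stdNormal = 0 := by
    simp_rw [mul_sub]
    rw [integral_sub (hF.integrable_mul_comp s) (hz.mul_const _), hF.integral_mul_comp, h0,
      integral_mul_const, integral_id_gaussianReal]
    simp
  have : NullSingletonClass stdNormal := nullSingletonClass_gaussianReal one_ne_zero
  have hne : ∀ᵐ z ∂stdNormal, z ≠ 0 :=
    measure_eq_zero_iff_ae_notMem.1 (measure_singleton (0 : ℝ))
  have hzero : ∀ᵐ z ∂stdNormal, z * (F (s * z) - F 0) = 0 := by
    rcases hF.continuous.strictMono_of_inj hF.injective with hmono | hanti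
    · refine (integral_eq_zero_iff_of_nonneg (fun z => ?_) hi).1 h
      rcases le_total 0 z with hz | hz
      · exact mul_nonneg hz (sub_nonneg.2 (hmono.monotone (by positivity)))
      · exact mul_nonneg_of_nonpos_of_nonpos hz
          (sub_nonpos.2 (hmono.monotone (mul_nonpos_of_nonneg_of_nonpos hs.le hz)))
    · have hh : ∫ z, -(z * (F (s * z) - F 0)) ∂stdNormal = 0 := by rw [integral_neg, h, neg_zero]
      have := (integral_eq_zero_iff_of_nonneg (fun z => ?_) hi.neg).1 hh
      · filter_upwards [this] with z hz
        simpa using hz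
      simp only [Pi.zero_apply, Pi.neg_apply]
      rw [← mul_neg, neg_sub]
      rcases le_total 0 z with hz | hz
      · exact mul_nonneg hz (sub_nonneg.2 (hanti.antitone (by positivity)))
      · exact mul_nonneg_of_nonpos_of_nonpos hz
          (sub_nonpos.2 (hanti.antitone (mul_nonpos_of_nonneg_of_nonpos hs.le hz)))
  have : ∀ᵐ z ∂stdNormal, False := by
    filter_upwards [hne, hzero] with z h1 h2
    have h3 : F (s * z) = F 0 := by
      rcases mul_eq_zero.1 h2 with h | h
      · exact absurd h h1
      · linarith
    have := hF.injective h3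
    rcases mul_eq_zero.1 this with h | h
    · exact hs.ne' h
    · exact h1 h
  simp [IsProbabilityMeasure.ne_zero] at this

end IsVolFunction

/-- `E[F(X) F(Y)]` for a centered Gaussian pair with common standard deviation `s` and
correlation `ρ`. -/
noncomputable def pairMean (F : ℝ → ℝ) (s ρ : ℝ) : ℝ :=
  ∫ q : ℝ × ℝ, F (s * q.1) * F (s * (ρ * q.1 + √(1 - ρ ^ 2) * q.2)) ∂(stdNormal.prod stdNormal)

lemma pairMean_zero (F : ℝ → ℝ) (s : ℝ) : pairMean F s 0 = avg s F 1 ^ 2 := by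
  rw [pairMean, avg_eq_integral]
  simpa [sq] using integral_prod_mul (μ := stdNormal) (ν := stdNormal)
    (fun x => F (s * x)) (fun x => F (s * x))

lemma pairMean_one (F : ℝ → ℝ) (s : ℝ) : pairMean F s 1 = avg s F 2 := by
  rw [pairMean, avg_eq_integral]
  have := integral_prod_mul (μ := stdNormal) (ν := stdNormal) (fun x => F (s * x) ^ 2) (fun _ => 1)
  simpa [sq] using this

/-- At `ρ = 0` the derivative of `√(1 - ρ²)` vanishes, so the differentiated integrand factors as `s
· q₁ F (s q₁) · F' (s q₂)`. One integration by parts in `q₁` produces the second factor `⟨F'⟩`. -/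
lemma IsVolFunction.hasDerivAt_pairMean {F : ℝ → ℝ} (hF : IsVolFunction F) (s : ℝ) :
    HasDerivAt (pairMean F s) (s ^ 2 * avg s (deriv F) 1 ^ 2) 0 := by
  obtain ⟨C, hC⟩ := hF.exists_abs_le
  obtain ⟨C', hC'⟩ := hF.exists_abs_deriv_le
  have hC0 : 0 ≤ C := (abs_nonneg _).trans (hC 0)
  have hC0' : 0 ≤ C' := (abs_nonneg _).trans (hC' 0)
  have hcF := hF.continuous
  have hcF' := hF.continuous_deriv
  have hz : Integrable (fun z : ℝ => z) stdNormal := (memLp_id_gaussianReal 1).integrable le_rfl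
  -- On `|ρ| < 1/2` the root is at least `1/2`, so the derivative of `√(1 - ρ²)` is bounded by `1`,
  -- the constant appearing in `bound`.
  have hU : Ioo (-(1 / 2) : ℝ) (1 / 2) ∈ 𝓝 (0 : ℝ) := Ioo_mem_nhds (by norm_num) (by norm_num)
  have hroot : ∀ ρ ∈ Ioo (-(1 / 2) : ℝ) (1 / 2), 1 / 4 ≤ 1 - ρ ^ 2 := by
    rintro ρ ⟨h1, h2⟩
    nlinarith
  have key := hasDerivAt_integral_of_dominated_loc_of_deriv_le
    (μ := stdNormal.prod stdNormal) (x₀ := (0 : ℝ)) (s := Ioo (-(1 / 2)) (1 / 2))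
    (F := fun ρ (q : ℝ × ℝ) => F (s * q.1) * F (s * (ρ * q.1 + √(1 - ρ ^ 2) * q.2)))
    (F' := fun ρ (q : ℝ × ℝ) => F (s * q.1) * (deriv F (s * (ρ * q.1 + √(1 - ρ ^ 2) * q.2))
      * (s * (q.1 + -(2 * ρ) / (2 * √(1 - ρ ^ 2)) * q.2))))
    (bound := fun q => C * (C' * (|s| * (|q.1| + 1 * |q.2|)))) hU
    (Eventually.of_forall fun ρ => (by fun_prop : Continuous _).aestronglyMeasurable)
    (by
      refine (integrable_const (C * C)).mono' (by fun_prop : Continuous _).aestronglyMeasurable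
        (ae_of_all _ fun q => ?_)
      rw [Real.norm_eq_abs, abs_mul]
      exact mul_le_mul (hC _) (hC _) (abs_nonneg _) hC0)
    (by fun_prop : Continuous _).aestronglyMeasurable
    (ae_of_all _ fun q ρ hρ => by
      have h4 := hroot ρ hρ
      have hs : 1 / 2 ≤ √(1 - ρ ^ 2) := Real.le_sqrt_of_sq_le (by norm_num; linarith)
      have hle : |-(2 * ρ) / (2 * √(1 - ρ ^ 2))| ≤ 1 := by
        rw [abs_div, abs_of_pos (by linarith : 0 < 2 * √(1 - ρ ^ 2)), div_le_one (by linarith),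
          abs_le]
        constructor <;> linarith [hρ.1, hρ.2]
      rw [Real.norm_eq_abs, abs_mul, abs_mul, abs_mul]
      gcongr
      · exact hC _
      · exact hC' _
      · refine (abs_add_le _ _).trans ?_
        rw [abs_mul]
        gcongr)
    ((((hz.abs.comp_fst _).add ((hz.abs.comp_snd _).const_mul 1)).const_mul _).const_mul _
      |>.const_mul _)
    (ae_of_all _ fun q ρ hρ => by
      have h4 := hroot ρ hρ
      have h1 : HasDerivAt (fun ρ : ℝ => 1 - ρ ^ 2) (-(2 * ρ)) ρ := by
        simpa using (hasDerivAt_pow 2 ρ).const_sub 1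
      have h2 := h1.sqrt (by linarith)
      have h3 := (((hasDerivAt_id ρ).mul_const q.1).add (h2.mul_const q.2)).const_mul s
      simp only [one_mul] at h3
      exact ((hF.hasDerivAt _).comp ρ h3).const_mul _)
  have h2 := key.2
  have e := integral_prod_mul (μ := stdNormal) (ν := stdNormal)
    (fun x => x * F (s * x)) (fun x => deriv F (s * x))
  rw [hF.integral_mul_comp] at e
  refine h2.congr_deriv (Eq.symm ?_)
  calc s ^ 2 * avg s (deriv F) 1 ^ 2 = s * (s * avg s (deriv F) 1 * ∫ x, deriv F (s * x) ∂stdNormal) := by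
        rw [avg_eq_integral]
        simp only [pow_one]
        ring
    _ = _ := by
        rw [← e, ← integral_const_mul]
        refine integral_congr_ae (ae_of_all _ fun q => ?_)
        simp
        ring

end

/-! ### `L²` representation and covariance of the fractional Ornstein–Uhlenbeck process -/

section

section ParametricIntegral

variable {α Ω : Type*} [MeasurableSpace α] [MeasurableSpace Ω] {μ : Measure α} {P : Measure Ω}
  [IsProbabilityMeasure μ] [IsProbabilityMeasure P] {X : Ω × α → ℝ}

/-- Jensen's inequality for the square, applied for almost every `ω`. -/
lemma memLp_two_integral (hX : MemLp X 2 (P.prod μ)) :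
    MemLp (fun ω => ∫ u, X (ω, u) ∂μ) 2 P := by
  have hX1 : Integrable X (P.prod μ) := hX.integrable one_le_two
  have hm : AEStronglyMeasurable (fun ω => ∫ u, X (ω, u) ∂μ) P :=
    hX1.aestronglyMeasurable.integral_prod_right'
  rw [memLp_two_iff_integrable_sq hm]
  refine hX.integrable_sq.integral_prod_left.mono' (hm.pow 2) ?_
  filter_upwards [hX1.prod_right_ae, hX.integrable_sq.prod_right_ae] with ω h1 h2
  rw [Real.norm_of_nonneg (sq_nonneg _)]
  exact (even_two.convexOn_pow (𝕜 := ℝ)).map_integral_le (by fun_prop) isClosed_univ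
    (ae_of_all _ fun _ => mem_univ _) h1 h2

lemma integral_integral_mul (hX : MemLp X 2 (P.prod μ)) {Y : Ω → ℝ} (hY : MemLp Y 2 P) :
    ∫ ω, (∫ u, X (ω, u) ∂μ) * Y ω ∂P = ∫ u, ∫ ω, X (ω, u) * Y ω ∂P ∂μ := by
  have h : Integrable (fun q : Ω × α => X q * Y q.1) (P.prod μ) :=
    hX.integrable_mul (hY.comp_fst μ)
  rw [← integral_integral_swap h]
  simp_rw [integral_mul_const]

end ParametricIntegral

variable {Ω : Type*} [MeasurableSpace Ω] {P : Measure Ω} {H σH : ℝ} {W : ℝ → Ω → ℝ}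

/-- A fractional Brownian motion is indistinguishable from one whose variables are all measurable
and whose paths are all continuous. -/
lemma IsFBM.exists_modification (hW : IsFBM P H σH W) :
    ∃ V : ℝ → Ω → ℝ, IsFBM P H σH V ∧ (∀ ω, Continuous fun t => V t ω) ∧
      (∀ t, Measurable (V t)) ∧ ∀ᵐ ω ∂P, ∀ t, W t ω = V t ω := by
  have hm := hW.gaussian.aemeasurable
  -- Measurable versions are compared at rational times only, so that a single null set suffices.
  -- Off the full-measure set `N` the process is set to zero, and continuity recovers measurability
  -- at real times.
  have hq : ∀ᵐ ω ∂P, ∀ q : ℚ, W q ω = (hm q).mk (W q) ω :=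
    ae_all_iff.2 fun q => (hm q).ae_eq_mk
  obtain ⟨N, hN, hNm, hNs⟩ := (hW.continuous_paths.and hq).exists_measurable_mem
  have hae : ∀ᵐ ω ∂P, ∀ t, W t ω = N.indicator (W t) ω := by
    filter_upwards [hN] with ω hω t
    rw [indicator_of_mem hω]
  have hae' : ∀ t, W t =ᵐ[P] N.indicator (W t) := fun t => by
    filter_upwards [hae] with ω h using h t
  have hc : ∀ ω, Continuous fun t => N.indicator (W t) ω := by
    intro ω
    by_cases hω : ω ∈ N
    · simpa [hω] using (hNs ω hω).1
    · simpa [hω] using continuous_const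
  have hmq : ∀ q : ℚ, Measurable (N.indicator (W q)) := by
    intro q
    have : N.indicator (W q) = N.indicator ((hm q).mk (W q)) :=
      indicator_congr fun ω hω => (hNs ω hω).2 q
    rw [this]
    exact (hm q).measurable_mk.indicator hNm
  refine ⟨fun t => N.indicator (W t), ⟨hW.gaussian.congr hae', fun t => ?_, fun t s => ?_,
    ae_of_all _ hc⟩, hc, fun t => ?_, hae⟩
  · rw [← hW.mean_zero t]
    exact integral_congr_ae (hae' t).symm
  · rw [← hW.cov t s]
    exact integral_congr_ae ((hae' t).symm.mul (hae' s).symm)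
  · obtain ⟨u, -, -, hu⟩ := Real.exists_seq_rat_strictMono_tendsto t
    exact measurable_of_tendsto_metrizable (fun n => hmq (u n))
      (tendsto_pi_nhds.2 fun ω => ((hc ω).tendsto t).comp hu)

lemma IsFBM.memLp (hW : IsFBM P H σH W) (t : ℝ) : MemLp (W t) 2 P :=
  (hW.gaussian.hasGaussianLaw_eval t).memLp_two

lemma IsFBM.integral_increment_mul_increment (hW : IsFBM P H σH W) (a b c d : ℝ) :
    ∫ ω, (W a ω - W b ω) * (W c ω - W d ω) ∂P
      = σH ^ 2 / 2 * (|a - d| ^ (2 * H) + |b - c| ^ (2 * H) - |a - c| ^ (2 * H)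
        - |b - d| ^ (2 * H)) := by
  have hi : ∀ s t, Integrable (fun ω => W s ω * W t ω) P := fun s t =>
    (hW.memLp s).integrable_mul (hW.memLp t)
  have h1 : Integrable (fun ω => W a ω * W c ω - W a ω * W d ω) P := (hi a c).sub (hi a d)
  have h2 : Integrable (fun ω => W b ω * W c ω - W b ω * W d ω) P := (hi b c).sub (hi b d)
  calc _ = ∫ ω, ((W a ω * W c ω - W a ω * W d ω) - (W b ω * W c ω - W b ω * W d ω)) ∂P := by
        congr 1
        ext ω
        ring
    _ = _ := by
        rw [integral_sub h1 h2, integral_sub (hi a c) (hi a d), integral_sub (hi b c) (hi b d),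
          hW.cov, hW.cov, hW.cov, hW.cov]
        ring

lemma setIntegral_Iic_exp_mul {ε : ℝ} (hε : 0 < ε) (t : ℝ) (g : ℝ → ℝ) :
    ∫ s in Iic t, Real.exp (-(t - s) / ε) * g s = ε * ∫ u, g (t - ε * u) ∂stdExp := by
  have h := integral_comp_mul_left_Ioi (fun x => Real.exp (-x / ε) * g (t - x)) 0 hε
  have e : ∀ u : ℝ, -(ε * u) / ε = -u := fun u => by field_simp
  simp only [e, mul_zero] at h
  simp only [integral_stdExp, smul_eq_mul, h]
  rw [mul_inv_cancel_left₀ hε.ne', ← integral_Ici_eq_integral_Ioi,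
    ← integral_indicator measurableSet_Iic, ← integral_indicator measurableSet_Ici,
    ← integral_sub_left_eq_self _ volume t]
  congr 1
  ext x
  by_cases hx : 0 ≤ x <;> simp [indicator, hx]

omit [MeasurableSpace Ω] in
lemma fOU_eq {ε : ℝ} (hε : 0 < ε) (t : ℝ) (ω : Ω) :
    fOU H ε W t ω = ε ^ (-H) * (W t ω - ∫ u, W (t - ε * u) ω ∂stdExp) := by
  rw [fOU, setIntegral_Iic_exp_mul hε t fun s => W s ω,
    show -1 - H = -H - 1 by ring, Real.rpow_sub_one hε.ne']
  field_simp

/-- The kernel whose integral against the exponential distribution is the fractional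
Ornstein-Uhlenbeck process. -/
noncomputable def fOUKernel (H ε : ℝ) (W : ℝ → Ω → ℝ) (t : ℝ) (q : Ω × ℝ) : ℝ :=
  ε ^ (-H) * (W t q.1 - W (t - ε * q.2) q.1)

variable {ε : ℝ}

/-- The second moment of the kernel at `u` is a multiple of `|ε u|^(2H)`, integrable against the
exponential law. Path continuity gives the joint measurability that Fubini requires. -/
lemma IsFBM.memLp_fOUKernel [IsProbabilityMeasure P] (hW : IsFBM P H σH W)
    (hc : ∀ ω, Continuous fun t => W t ω) (hm : ∀ t, Measurable (W t))
    (hH : 0 < H) (hH1 : H < 1) (t : ℝ) :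
    MemLp (fOUKernel H ε W t) 2 (P.prod stdExp) := by
  have hu : Measurable fun q : ℝ × Ω => W q.1 q.2 :=
    measurable_uncurry_of_continuous_of_measurable hc hm
  have hk : Measurable (fOUKernel H ε W t) := by
    have h1 : Measurable fun q : Ω × ℝ => W t q.1 := (hm t).comp measurable_fst
    have h2 : Measurable fun q : Ω × ℝ => W (t - ε * q.2) q.1 :=
      hu.comp (by fun_prop : Measurable fun q : Ω × ℝ => (t - ε * q.2, q.1))
    exact (h1.sub h2).const_mul _
  rw [memLp_two_iff_integrable_sq hk.aestronglyMeasurable,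
    integrable_prod_iff' (hk.pow_const 2).aestronglyMeasurable]
  have hL : ∀ u, MemLp (fun ω => fOUKernel H ε W t (ω, u)) 2 P := fun u =>
    ((hW.memLp t).sub (hW.memLp (t - ε * u))).const_mul _
  refine ⟨ae_of_all _ fun u => (hL u).integrable_sq, ?_⟩
  have e : ∀ u, ∫ ω, ‖fOUKernel H ε W t (ω, u) ^ 2‖ ∂P
      = (ε ^ (-H)) ^ 2 * (σH ^ 2 * |0 + ε * u| ^ (2 * H)) := by
    intro u
    have h := hW.integral_increment_mul_increment t (t - ε * u) t (t - ε * u)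
    simp_rw [Real.norm_of_nonneg (sq_nonneg _), fOUKernel, mul_pow, sq (_ - _)]
    rw [integral_const_mul, h]
    rw [sub_sub_cancel, show t - ε * u - t = -(ε * u) by ring, abs_neg, sub_self, sub_self,
      abs_zero, Real.zero_rpow (by linarith), zero_add]
    ring
  simp_rw [e]
  exact ((integrable_abs_add_mul_rpow (by linarith) (by linarith) 0 ε).const_mul _).const_mul _

/-- Only almost sure: splitting the integral of the difference requires the path to be integrable
against the exponential weight, which Fubini gives for almost every `ω`. -/
lemma IsFBM.fOU_ae_eq [IsProbabilityMeasure P] (hW : IsFBM P H σH W)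
    (hc : ∀ ω, Continuous fun t => W t ω) (hm : ∀ t, Measurable (W t))
    (hH : 0 < H) (hH1 : H < 1) (hε : 0 < ε) (t : ℝ) :
    fOU H ε W t =ᵐ[P] fun ω => ∫ u, fOUKernel H ε W t (ω, u) ∂stdExp := by
  filter_upwards [((hW.memLp_fOUKernel hc hm hH hH1 t (ε := ε)).integrable
    one_le_two).prod_right_ae] with ω h
  have hne : ε ^ (-H) ≠ 0 := (Real.rpow_pos_of_pos hε _).ne'
  have h1 : Integrable (fun u => W t ω - W (t - ε * u) ω) stdExp := by
    refine (h.const_mul (ε ^ (-H))⁻¹).congr (ae_of_all _ fun u => ?_)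
    simp only [fOUKernel]
    rw [inv_mul_cancel_left₀ hne]
  have h2 : Integrable (fun u => W (t - ε * u) ω) stdExp := by
    refine ((integrable_const (W t ω)).sub h1).congr (ae_of_all _ fun u => ?_)
    simp
  simp only [fOUKernel, fOU_eq hε]
  rw [integral_const_mul, integral_sub (integrable_const _) h2]
  simp

lemma IsFBM.memLp_fOU [IsProbabilityMeasure P] (hW : IsFBM P H σH W)
    (hc : ∀ ω, Continuous fun t => W t ω) (hm : ∀ t, Measurable (W t))
    (hH : 0 < H) (hH1 : H < 1) (hε : 0 < ε) (t : ℝ) : MemLp (fOU H ε W t) 2 P :=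
  (memLp_congr_ae (hW.fOU_ae_eq hc hm hH hH1 hε t)).2
    (memLp_two_integral (hW.memLp_fOUKernel hc hm hH hH1 t))

lemma IsFBM.integral_fOU_mul [IsProbabilityMeasure P] (hW : IsFBM P H σH W)
    (hc : ∀ ω, Continuous fun t => W t ω) (hm : ∀ t, Measurable (W t))
    (hH : 0 < H) (hH1 : H < 1) (hε : 0 < ε) (t : ℝ) {Y : Ω → ℝ} (hY : MemLp Y 2 P) :
    ∫ ω, fOU H ε W t ω * Y ω ∂P = ∫ u, ∫ ω, fOUKernel H ε W t (ω, u) * Y ω ∂P ∂stdExp := by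
  rw [← integral_integral_mul (hW.memLp_fOUKernel hc hm hH hH1 t) hY]
  exact integral_congr_ae ((hW.fOU_ae_eq hc hm hH hH1 hε t).mul EventuallyEq.rfl)

/-- Fubini is applied once for each factor, reducing the claim to the covariance of increments under
two exponential averages. -/
lemma IsFBM.integral_fOU_mul_fOU [IsProbabilityMeasure P] (hW : IsFBM P H σH W)
    (hc : ∀ ω, Continuous fun t => W t ω) (hm : ∀ t, Measurable (W t))
    (hH : 0 < H) (hH1 : H < 1) (hε : 0 < ε) (t t' : ℝ) :
    ∫ ω, fOU H ε W t ω * fOU H ε W t' ω ∂P = fouCov H σH ((t' - t) / ε) := by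
  rw [hW.integral_fOU_mul hc hm hH hH1 hε t (hW.memLp_fOU hc hm hH hH1 hε t'),
    ← integral_integral_increment_cov hH hH1]
  refine integral_congr_ae (ae_of_all _ fun u => ?_)
  have hL : MemLp (fun ω => fOUKernel H ε W t (ω, u)) 2 P :=
    ((hW.memLp t).sub (hW.memLp (t - ε * u))).const_mul _
  simp_rw [mul_comm (fOUKernel H ε W t _)]
  rw [hW.integral_fOU_mul hc hm hH hH1 hε t' hL]
  refine integral_congr_ae (ae_of_all _ fun v => ?_)
  simp only [fOUKernel]
  have h := hW.integral_increment_mul_increment t' (t' - ε * v) t (t - ε * u)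
  calc _ = ∫ ω, (ε ^ (-H)) ^ 2 * ((W t' ω - W (t' - ε * v) ω) * (W t ω - W (t - ε * u) ω)) ∂P := by
        congr 1
        ext ω
        ring
    _ = _ := by
        rw [integral_const_mul, h]
        set τ := (t' - t) / ε with hτ
        have ht : t' - t = ε * τ := by rw [hτ]; field_simp
        rw [show t' - (t - ε * u) = ε * (τ + u) by linear_combination ht,
          show t' - ε * v - t = ε * (τ - v) by linear_combination ht,
          show t' - ε * v - (t - ε * u) = ε * (τ + u - v) by linear_combination ht, ht]
        simp_rw [abs_mul, Real.mul_rpow (abs_nonneg _) (abs_nonneg _), abs_of_pos hε]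
        -- Self-similarity: the normalization `ε^(-H)` exactly cancels the scaling of the
        -- increments, so only `τ` remains.
        have : (ε ^ (-H)) ^ 2 * ε ^ (2 * H) = 1 := by
          rw [← Real.rpow_natCast, ← Real.rpow_mul hε.le, ← Real.rpow_add hε]
          norm_num
          rw [show -(H * 2) + 2 * H = 0 by ring, Real.rpow_zero]
        linear_combination (σH ^ 2 / 2 * (|τ - v| ^ (2 * H) + |τ + u| ^ (2 * H) - |τ| ^ (2 * H)
          - |τ + u - v| ^ (2 * H))) * this

end

/-! ### Gaussianity through closure in `L²` -/

section

section GaussianClosure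

variable {Ω : Type*} [MeasurableSpace Ω] {P : Measure Ω} [IsProbabilityMeasure P]

lemma norm_exp_I_mul_sub_exp_I_mul_le (x y : ℝ) :
    ‖Complex.exp (Complex.I * x) - Complex.exp (Complex.I * y)‖ ≤ |x - y| := by
  have h : Complex.exp (Complex.I * x) - Complex.exp (Complex.I * y)
      = Complex.exp (Complex.I * y) * (Complex.exp (Complex.I * (x - y : ℝ)) - 1) := by
    rw [mul_sub, mul_one, ← Complex.exp_add]
    congr 2
    push_cast
    ring
  rw [h, norm_mul, Complex.norm_exp_I_mul_ofReal, one_mul]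
  exact Real.norm_exp_I_mul_ofReal_sub_one_le

lemma integrable_exp_I_mul {X : Ω → ℝ} (hX : AEStronglyMeasurable X P) :
    Integrable (fun ω => Complex.exp (Complex.I * X ω)) P :=
  (integrable_const (1 : ℝ)).mono' (by fun_prop)
    (ae_of_all _ fun ω => (Complex.norm_exp_I_mul_ofReal _).le)

/-- The map `x ↦ exp (i x)` is 1-Lipschitz, and the `L¹` norm is at most the `L²` norm on a
probability space. -/
lemma continuous_integral_exp_I_mul :
    Continuous fun X : Lp ℝ 2 P => ∫ ω, Complex.exp (Complex.I * X ω) ∂P := by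
  refine (LipschitzWith.of_dist_le_mul (K := 1) fun X Y => ?_).continuous
  have hX := Lp.aestronglyMeasurable X
  have hY := Lp.aestronglyMeasurable Y
  rw [dist_eq_norm, ← integral_sub (integrable_exp_I_mul hX) (integrable_exp_I_mul hY)]
  have hd : MemLp (fun ω => X ω - Y ω) 2 P := (Lp.memLp X).sub (Lp.memLp Y)
  have hi : Integrable (fun ω => X ω - Y ω) P := hd.integrable one_le_two
  calc _ ≤ ∫ ω, |X ω - Y ω| ∂P :=
        norm_integral_le_of_norm_le hi.abs
          (ae_of_all _ fun ω => norm_exp_I_mul_sub_exp_I_mul_le _ _)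
    _ = (eLpNorm (fun ω => X ω - Y ω) 1 P).toReal := by
        rw [eLpNorm_one_eq_lintegral_enorm, ← integral_norm_eq_lintegral_enorm hi.1]
        rfl
    _ ≤ (eLpNorm (fun ω => X ω - Y ω) 2 P).toReal :=
        ENNReal.toReal_mono hd.eLpNorm_ne_top
          (eLpNorm_le_eLpNorm_of_exponent_le one_le_two hd.1)
    _ = _ := by
        rw [NNReal.coe_one, one_mul, dist_eq_norm, Lp.norm_def]
        congr 1
        exact eLpNorm_congr_ae (Lp.coeFn_sub X Y).symm

omit [IsProbabilityMeasure P] in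
lemma coeFn_finsetSum_Lp {ι : Type*} (s : Finset ι) (X : ι → Lp ℝ 2 P) :
    ⇑(∑ i ∈ s, X i) =ᵐ[P] fun ω => ∑ i ∈ s, X i ω := by
  classical
  induction s using Finset.induction_on with
  | empty =>
    filter_upwards [Lp.coeFn_zero ℝ 2 P] with ω h
    simpa using h
  | insert i s hi ih =>
    rw [Finset.sum_insert hi]
    filter_upwards [Lp.coeFn_add (X i) (∑ i ∈ s, X i), ih] with ω h1 h2
    rw [h1, Pi.add_apply, h2, Finset.sum_insert hi]

omit [IsProbabilityMeasure P] in
lemma integral_sq_eq_norm_sq (X : Lp ℝ 2 P) : ∫ ω, X ω ^ 2 ∂P = ‖X‖ ^ 2 := by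
  rw [← real_inner_self_eq_norm_sq, L2.inner_def]
  simp [sq]

/-- In a topological closure in `L²`, the centered Gaussian form of the characteristic function
persists. -/
lemma integral_exp_I_mul_of_mem_closure {K : Submodule ℝ (Lp ℝ 2 P)}
    (hK : ∀ X ∈ K, ∫ ω, Complex.exp (Complex.I * X ω) ∂P
      = Real.exp (-(∫ ω, X ω ^ 2 ∂P) / 2)) {X : Lp ℝ 2 P} (hX : X ∈ K.topologicalClosure) :
    ∫ ω, Complex.exp (Complex.I * X ω) ∂P = Real.exp (-(∫ ω, X ω ^ 2 ∂P) / 2) := by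
  have hc : IsClosed {X : Lp ℝ 2 P | ∫ ω, Complex.exp (Complex.I * X ω) ∂P
      = (Real.exp (-(∫ ω, X ω ^ 2 ∂P) / 2) : ℝ)} := by
    refine isClosed_eq continuous_integral_exp_I_mul ?_
    simp_rw [integral_sq_eq_norm_sq]
    fun_prop
  exact closure_minimal (s := (K : Set (Lp ℝ 2 P))) (fun X hX => hK X hX) hc hX

end GaussianClosure

variable {Ω : Type*} [MeasurableSpace Ω] {P : Measure Ω} [IsProbabilityMeasure P] {H σH : ℝ}
  {W : ℝ → Ω → ℝ}

/-- The linear span in `L²` of a fractional Brownian motion. -/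
noncomputable def fbmSpan (hW : IsFBM P H σH W) : Submodule ℝ (Lp ℝ 2 P) :=
  Submodule.span ℝ (range fun t => (hW.memLp t).toLp (W t))

lemma exists_finsupp_of_mem_fbmSpan (hW : IsFBM P H σH W) {X : Lp ℝ 2 P} (hX : X ∈ fbmSpan hW) :
    ∃ c : ℝ →₀ ℝ, X =ᵐ[P] fun ω => c.sum fun t a => a * W t ω := by
  induction hX using Submodule.span_induction with
  | mem X h =>
    obtain ⟨t, rfl⟩ := h
    refine ⟨Finsupp.single t 1, ?_⟩
    filter_upwards [(hW.memLp t).coeFn_toLp] with ω h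
    simp [h]
  | zero =>
    refine ⟨0, ?_⟩
    filter_upwards [Lp.coeFn_zero ℝ 2 P] with ω h
    simp
  | add X Y _ _ hX hY =>
    obtain ⟨c, hc⟩ := hX
    obtain ⟨d, hd⟩ := hY
    refine ⟨c + d, ?_⟩
    filter_upwards [Lp.coeFn_add X Y, hc, hd] with ω h1 h2 h3
    rw [h1, Pi.add_apply, h2, h3, Finsupp.sum_add_index' (by simp) (by intros; ring)]
  | smul a X _ hX =>
    obtain ⟨c, hc⟩ := hX
    refine ⟨a • c, ?_⟩
    filter_upwards [Lp.coeFn_smul a X, hc] with ω h1 h2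
    rw [h1, Pi.smul_apply, h2, Finsupp.sum_smul_index (by simp), smul_eq_mul, Finsupp.mul_sum]
    simp [mul_assoc]

omit [IsProbabilityMeasure P] in
lemma integral_exp_I_mul_of_hasGaussianLaw {X : Ω → ℝ} (hX : HasGaussianLaw X P)
    (h0 : ∫ ω, X ω ∂P = 0) :
    ∫ ω, Complex.exp (Complex.I * X ω) ∂P = Real.exp (-(∫ ω, X ω ^ 2 ∂P) / 2) := by
  have h := charFun_gaussianReal (μ := P[X]) (v := Var[X; P].toNNReal) 1
  rw [← hX.map_eq_gaussianReal, charFun_apply_real,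
    integral_map hX.aemeasurable (by fun_prop), h0,
    variance_of_integral_eq_zero hX.aemeasurable h0] at h
  rw [Real.coe_toNNReal _ (integral_nonneg fun ω => sq_nonneg _)] at h
  convert h using 1
  · simp [mul_comm]
  · push_cast
    congr 1
    ring

lemma integral_exp_I_mul_of_mem_fbmSpan (hW : IsFBM P H σH W) {X : Lp ℝ 2 P}
    (hX : X ∈ fbmSpan hW) :
    ∫ ω, Complex.exp (Complex.I * X ω) ∂P = Real.exp (-(∫ ω, X ω ^ 2 ∂P) / 2) := by
  obtain ⟨c, hc⟩ := exists_finsupp_of_mem_fbmSpan hW hX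
  have hG : HasGaussianLaw (fun ω => c.sum fun t a => a * W t ω) P :=
    (hW.gaussian.smul c).hasGaussianLaw_fun_sum (I := c.support)
  refine integral_exp_I_mul_of_hasGaussianLaw (hG.congr hc.symm) ?_
  rw [integral_congr_ae hc]
  simp only [Finsupp.sum]
  rw [integral_finsetSum _ fun t _ => ((hW.memLp t).integrable one_le_two).const_mul _]
  simp [integral_const_mul, hW.mean_zero]

variable {ε : ℝ}

/-- Uses the double orthogonal complement in place of Riemann sums: a `Y` orthogonal to every `W_s`
is orthogonal to every slice of the kernel, hence by Fubini to their average. -/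
lemma toLp_fOU_mem_closure (hW : IsFBM P H σH W)
    (hc : ∀ ω, Continuous fun t => W t ω) (hm : ∀ t, Measurable (W t))
    (hH : 0 < H) (hH1 : H < 1) (hε : 0 < ε) (t : ℝ) :
    (hW.memLp_fOU hc hm hH hH1 hε t).toLp (fOU H ε W t) ∈ (fbmSpan hW).topologicalClosure := by
  rw [← Submodule.orthogonal_orthogonal_eq_closure, Submodule.mem_orthogonal']
  intro Y hY
  have horth : ∀ s, ∫ ω, W s ω * Y ω ∂P = 0 := by
    intro s
    have h := (Submodule.mem_orthogonal _ _).1 hY _ (Submodule.subset_span (mem_range_self s))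
    rw [L2.inner_def] at h
    rw [← h]
    refine integral_congr_ae ?_
    filter_upwards [(hW.memLp s).coeFn_toLp] with ω h
    simp [h, mul_comm]
  have hYL := Lp.memLp Y
  have hi : ∀ s, Integrable (fun ω => W s ω * Y ω) P := fun s => (hW.memLp s).integrable_mul hYL
  rw [L2.inner_def]
  calc _ = ∫ ω, fOU H ε W t ω * Y ω ∂P := by
        refine integral_congr_ae ?_
        filter_upwards [(hW.memLp_fOU hc hm hH hH1 hε t).coeFn_toLp] with ω h
        simp [h, mul_comm]
    _ = 0 := by
        rw [hW.integral_fOU_mul hc hm hH hH1 hε t hYL]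
        simp only [fOUKernel, mul_assoc, sub_mul, integral_const_mul]
        simp_rw [integral_sub (hi _) (hi _), horth]
        simp

/-- The joint characteristic function at any finite set of times. Linear combinations stay in the
closed span, so their characteristic function is determined by their second moment. -/
lemma integral_exp_I_mul_sum_fOU (hW : IsFBM P H σH W)
    (hH : 0 < H) (hH1 : H < 1) (hε : 0 < ε) {ι : Type*} [Fintype ι] (c t : ι → ℝ) :
    ∫ ω, Complex.exp (Complex.I * (∑ i, c i * fOU H ε W (t i) ω : ℝ)) ∂P
      = Real.exp (-(∑ i, ∑ j, c i * c j * fouCov H σH ((t j - t i) / ε)) / 2) := by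
  obtain ⟨V, hV, hc, hm, hae⟩ := hW.exists_modification
  have hZ := hV.memLp_fOU hc hm hH hH1 hε
  have hmem := toLp_fOU_mem_closure hV hc hm hH hH1 hε
  set X : Lp ℝ 2 P := ∑ i, c i • (hZ (t i)).toLp (fOU H ε V (t i)) with hX
  have hXmem : X ∈ (fbmSpan hV).topologicalClosure :=
    Submodule.sum_mem _ fun i _ => Submodule.smul_mem _ _ (hmem _)
  have hXae : X =ᵐ[P] fun ω => ∑ i, c i * fOU H ε V (t i) ω := by
    have h : ∀ᵐ ω ∂P, ∀ i, (c i • (hZ (t i)).toLp (fOU H ε V (t i))) ω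
        = c i * fOU H ε V (t i) ω := by
      refine ae_all_iff.2 fun i => ?_
      filter_upwards [Lp.coeFn_smul (c i) ((hZ (t i)).toLp (fOU H ε V (t i))),
        (hZ (t i)).coeFn_toLp] with ω h1 h2
      rw [h1, Pi.smul_apply, h2, smul_eq_mul]
    filter_upwards [coeFn_finsetSum_Lp Finset.univ
      fun i => c i • (hZ (t i)).toLp (fOU H ε V (t i)), h] with ω h1 h2
    rw [hX, h1]
    exact Finset.sum_congr rfl fun i _ => h2 i
  have key := integral_exp_I_mul_of_mem_closure
    (fun X hX => integral_exp_I_mul_of_mem_fbmSpan hV hX) hXmem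
  -- `W` and its modification agree at all times off one null set, so the path integrals agree too.
  have hWV : ∀ᵐ ω ∂P, ∀ s, fOU H ε W s ω = fOU H ε V s ω := by
    filter_upwards [hae] with ω h s
    simp only [fOU, h]
  have e1 : ∫ ω, Complex.exp (Complex.I * (∑ i, c i * fOU H ε W (t i) ω : ℝ)) ∂P
      = ∫ ω, Complex.exp (Complex.I * X ω) ∂P := by
    refine integral_congr_ae ?_
    filter_upwards [hXae, hWV] with ω h1 h2
    simp_rw [h1, h2]
  have hi : ∀ i j, Integrable (fun ω => c i * c j * (fOU H ε V (t i) ω * fOU H ε V (t j) ω)) P :=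
    fun i j => ((hZ (t i)).integrable_mul (hZ (t j))).const_mul _
  have e2 : ∫ ω, X ω ^ 2 ∂P = ∑ i, ∑ j, c i * c j * fouCov H σH ((t j - t i) / ε) := by
    calc _ = ∫ ω, ∑ i, ∑ j, c i * c j * (fOU H ε V (t i) ω * fOU H ε V (t j) ω) ∂P := by
          refine integral_congr_ae ?_
          filter_upwards [hXae] with ω h
          rw [h, sq, Finset.sum_mul_sum]
          refine Finset.sum_congr rfl fun i _ => Finset.sum_congr rfl fun j _ => ?_
          ring
      _ = _ := by
          rw [integral_finsetSum _ fun i _ => integrable_finsetSum _ fun j _ => hi i j]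
          refine Finset.sum_congr rfl fun i _ => ?_
          rw [integral_finsetSum _ fun j _ => hi i j]
          refine Finset.sum_congr rfl fun j _ => ?_
          rw [integral_const_mul, hV.integral_fOU_mul_fOU hc hm hH hH1 hε]
  rw [e1, key, e2]

lemma IsFBM.aemeasurable_fOU (hW : IsFBM P H σH W)
    (hH : 0 < H) (hH1 : H < 1) (hε : 0 < ε) (t : ℝ) : AEMeasurable (fOU H ε W t) P := by
  obtain ⟨V, hV, hc, hm, hae⟩ := hW.exists_modification
  refine (hV.memLp_fOU hc hm hH hH1 hε t).1.aemeasurable.congr ?_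
  filter_upwards [hae] with ω h
  simp only [fOU, h]

end

/-! ### Finite-dimensional laws and moments of the volatility -/

section

section Laws

variable {Ω : Type*} [MeasurableSpace Ω] {P : Measure Ω} [IsProbabilityMeasure P] {H σH ε : ℝ}
  {W : ℝ → Ω → ℝ}

lemma fouCov_neg (H σH τ : ℝ) : fouCov H σH (-τ) = fouCov H σH τ := by
  have h1 : ∀ u, |-τ + u| = |τ - u| := fun u => by rw [← abs_neg]; ring_nf
  have h2 : ∀ u, |-τ - u| = |τ + u| := fun u => by rw [← abs_neg]; ring_nf
  simp only [fouCov, h1, h2, abs_neg]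
  ring

/-- The joint characteristic function involves the times only through their differences, which a
shift preserves. -/
lemma IsFBM.identDistrib_fOU (hW : IsFBM P H σH W) (hH : 0 < H) (hH1 : H < 1) (hε : 0 < ε)
    (h : ℝ) (I : Finset ℝ) :
    IdentDistrib (fun ω (i : I) => fOU H ε W (i + h) ω) (fun ω (i : I) => fOU H ε W i ω) P P := by
  have hZ := hW.aemeasurable_fOU hH hH1 hε
  have hm1 : AEMeasurable (fun ω (i : I) => fOU H ε W (i + h) ω) P :=
    aemeasurable_pi_lambda _ fun i => hZ _
  have hm2 : AEMeasurable (fun ω (i : I) => fOU H ε W i ω) P :=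
    aemeasurable_pi_lambda _ fun i => hZ _
  refine ⟨hm1, hm2, ?_⟩
  have := Measure.isProbabilityMeasure_map hm1
  have := Measure.isProbabilityMeasure_map hm2
  apply Measure.ext_of_charFunDual
  ext L
  rw [charFunDual_apply, charFunDual_apply, integral_map hm1 (by fun_prop),
    integral_map hm2 (by fun_prop)]
  obtain ⟨c, hL⟩ : ∃ c : I → ℝ, ∀ x : I → ℝ, L x = ∑ i, c i * x i := by
    refine ⟨fun i => L (fun j => if i = j then 1 else 0), fun x => ?_⟩
    have := LinearMap.pi_apply_eq_sum_univ (L : (I → ℝ) →ₗ[ℝ] ℝ) x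
    simpa [mul_comm] using this
  simp_rw [hL, mul_comm _ Complex.I]
  rw [integral_exp_I_mul_sum_fOU hW hH hH1 hε _ fun i : I => (i : ℝ) + h,
    integral_exp_I_mul_sum_fOU hW hH hH1 hε _ fun i : I => (i : ℝ)]
  simp

lemma IsFBM.integral_exp_pair (hW : IsFBM P H σH W) (hH : 0 < H) (hH1 : H < 1) (hε : 0 < ε)
    (t t' a b : ℝ) :
    ∫ ω, Complex.exp (Complex.I * (a * fOU H ε W t ω + b * fOU H ε W t' ω : ℝ)) ∂P
      = Real.exp (-((a ^ 2 + b ^ 2) * sigmaOU H σH ^ 2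
        + 2 * a * b * fouCov H σH ((t' - t) / ε)) / 2) := by
  have h := integral_exp_I_mul_sum_fOU hW hH hH1 hε ![a, b] ![t, t']
  simp only [Fin.sum_univ_two, Matrix.cons_val_zero, Matrix.cons_val_one, sub_self, zero_div,
    fouCov_zero hH] at h
  rw [h, show (t - t') / ε = -((t' - t) / ε) by ring, fouCov_neg]
  congr 3
  ring

/-- A characteristic function is bounded by `1`, so the exponents for `Z_0 ± Z_τ` are nonpositive.
This Cauchy–Schwarz bound ensures `1 - ρ² ≥ 0` in the representation of pairs. -/
lemma IsFBM.abs_fouCov_le (hW : IsFBM P H σH W) (hH : 0 < H) (hH1 : H < 1) (τ : ℝ) :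
    |fouCov H σH τ| ≤ sigmaOU H σH ^ 2 := by
  have key : ∀ b : ℝ, b ^ 2 = 1 → 0 ≤ 2 * sigmaOU H σH ^ 2 + 2 * b * fouCov H σH τ := by
    intro b hb
    have h := hW.integral_exp_pair hH hH1 one_pos 0 τ 1 b
    have hn : ‖∫ ω, Complex.exp (Complex.I * (1 * fOU H 1 W 0 ω + b * fOU H 1 W τ ω : ℝ)) ∂P‖
        ≤ 1 := by
      simpa using norm_integral_le_of_norm_le_const (μ := P) (C := 1)
        (ae_of_all _ fun ω => (Complex.norm_exp_I_mul_ofReal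
          (1 * fOU H 1 W 0 ω + b * fOU H 1 W τ ω)).le)
    rw [h, Complex.norm_real, Real.norm_of_nonneg (Real.exp_pos _).le, Real.exp_le_one_iff,
      hb] at hn
    simp only [sub_zero, div_one] at hn
    linarith
  rw [abs_le]
  constructor <;> linarith [key 1 (by norm_num), key (-1) (by norm_num)]

lemma integral_exp_I_mul_stdNormal (x : ℝ) :
    ∫ z : ℝ, Complex.exp (Complex.I * (x * z : ℝ)) ∂stdNormal = Real.exp (-x ^ 2 / 2) := by
  have h := charFun_gaussianReal (μ := 0) (v := 1) x
  rw [charFun_apply_real] at h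
  convert h using 1
  · congr 1
    ext z
    push_cast
    ring_nf
  · push_cast
    congr 1
    ring_nf

lemma integral_exp_I_mul_stdNormal_pair (x y : ℝ) :
    ∫ q : ℝ × ℝ, Complex.exp (Complex.I * (x * q.1 + y * q.2 : ℝ)) ∂(stdNormal.prod stdNormal)
      = Real.exp (-(x ^ 2 + y ^ 2) / 2) := by
  have h := integral_prod_mul (μ := stdNormal) (ν := stdNormal)
    (fun z => Complex.exp (Complex.I * (x * z : ℝ))) (fun z => Complex.exp (Complex.I * (y * z : ℝ)))
  rw [integral_exp_I_mul_stdNormal, integral_exp_I_mul_stdNormal, ← Complex.ofReal_mul,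
    ← Real.exp_add] at h
  rw [show -(x ^ 2 + y ^ 2) / 2 = -x ^ 2 / 2 + -y ^ 2 / 2 by ring, ← h]
  congr 1
  ext q
  rw [← Complex.exp_add]
  congr 1
  push_cast
  ring

/-- Both sides are centered Gaussian with the same covariance matrix, the right one in Cholesky
form; the comparison is made on characteristic functions. -/
lemma IsFBM.identDistrib_pair (hW : IsFBM P H σH W) (hH : 0 < H) (hH1 : H < 1) (hσ : 0 < σH)
    (hε : 0 < ε) (t t' : ℝ) {ρ : ℝ} (hρ : fouCov H σH ((t' - t) / ε) = sigmaOU H σH ^ 2 * ρ) :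
    IdentDistrib (fun ω => (fOU H ε W t ω, fOU H ε W t' ω))
      (fun q : ℝ × ℝ => (sigmaOU H σH * q.1, sigmaOU H σH * (ρ * q.1 + √(1 - ρ ^ 2) * q.2)))
      P (stdNormal.prod stdNormal) := by
  have hs := sigmaOU_pos hH hσ
  have hρ1 : 0 ≤ 1 - ρ ^ 2 := by
    have h := hW.abs_fouCov_le hH hH1 ((t' - t) / ε)
    rw [hρ, abs_mul, abs_of_pos (by positivity)] at h
    have : |ρ| ≤ 1 := le_of_mul_le_mul_left (by linarith) (pow_pos hs 2)
    nlinarith [sq_abs ρ, abs_nonneg ρ]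
  have hZ := hW.aemeasurable_fOU hH hH1 hε
  have hm1 : AEMeasurable (fun ω => (fOU H ε W t ω, fOU H ε W t' ω)) P := (hZ t).prodMk (hZ t')
  have hm2 : AEMeasurable (fun q : ℝ × ℝ => (sigmaOU H σH * q.1,
    sigmaOU H σH * (ρ * q.1 + √(1 - ρ ^ 2) * q.2))) (stdNormal.prod stdNormal) := by fun_prop
  refine ⟨hm1, hm2, ?_⟩
  have := Measure.isProbabilityMeasure_map hm1
  have := Measure.isProbabilityMeasure_map hm2
  apply Measure.ext_of_charFunDual
  ext L
  rw [charFunDual_apply, charFunDual_apply, integral_map hm1 (by fun_prop),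
    integral_map hm2 (by fun_prop)]
  obtain ⟨a, b, hL⟩ : ∃ a b : ℝ, ∀ x y : ℝ, L (x, y) = a * x + b * y := by
    refine ⟨L (1, 0), L (0, 1), fun x y => ?_⟩
    have : ((x, y) : ℝ × ℝ) = x • (1, 0) + y • (0, 1) := by simp
    rw [this, map_add, map_smul, map_smul, smul_eq_mul, smul_eq_mul]
    ring
  simp_rw [hL, mul_comm _ Complex.I]
  rw [hW.integral_exp_pair hH hH1 hε, hρ]
  have h := integral_exp_I_mul_stdNormal_pair (sigmaOU H σH * (a + b * ρ))
    (sigmaOU H σH * b * √(1 - ρ ^ 2))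
  rw [mul_pow _ (√_), Real.sq_sqrt hρ1] at h
  convert h.symm using 2
  · congr 2
    ring
  · ext q
    congr 3
    ring

variable {F : ℝ → ℝ}

lemma IsFBM.integral_vol_mul_vol (hW : IsFBM P H σH W) (hH : 0 < H) (hH1 : H < 1) (hσ : 0 < σH)
    (hF : IsVolFunction F) (hε : 0 < ε) (t t' : ℝ) :
    ∫ ω, vol H ε F W t ω * vol H ε F W t' ω ∂P
      = pairMean F (sigmaOU H σH) (fouCov H σH ((t' - t) / ε) / sigmaOU H σH ^ 2) := by
  have hs := sigmaOU_pos hH hσ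
  have h := hW.identDistrib_pair hH hH1 hσ hε t t'
    (ρ := fouCov H σH ((t' - t) / ε) / sigmaOU H σH ^ 2) (by field_simp)
  have hm : Measurable fun q : ℝ × ℝ => F q.1 * F q.2 := by
    have := hF.continuous
    fun_prop
  exact (h.comp hm).integral_eq

lemma IsFBM.integral_vol (hW : IsFBM P H σH W) (hH : 0 < H) (hH1 : H < 1) (hσ : 0 < σH)
    (hF : IsVolFunction F) (hε : 0 < ε) (t : ℝ) :
    ∫ ω, vol H ε F W t ω ∂P = avg (sigmaOU H σH) F 1 := by
  -- The one-time law is read off from the degenerate pair `t' = t`, for which `ρ = 1`.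
  have h := hW.identDistrib_pair hH hH1 hσ hε t t (ρ := 1) (by simp [fouCov_zero hH])
  have hm : Measurable fun q : ℝ × ℝ => F q.1 := by
    have := hF.continuous
    fun_prop
  have he := (h.comp hm).integral_eq
  have hp := integral_prod_mul (μ := stdNormal) (ν := stdNormal)
    (fun z => F (sigmaOU H σH * z)) (fun _ => 1)
  simp only [mul_one, integral_const, probReal_univ, smul_eq_mul] at hp
  rw [avg_eq_integral]
  simp only [pow_one]
  exact he.trans hp

lemma IsFBM.memLp_vol (hW : IsFBM P H σH W) (hH : 0 < H) (hH1 : H < 1)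
    (hF : IsVolFunction F) (hε : 0 < ε) (t : ℝ) : MemLp (vol H ε F W t) 2 P :=
  hF.memLp_comp (hW.aemeasurable_fOU hH hH1 hε t)

lemma IsFBM.covariance_vol (hW : IsFBM P H σH W) (hH : 0 < H) (hH1 : H < 1) (hσ : 0 < σH)
    (hF : IsVolFunction F) (hε : 0 < ε) (t t' : ℝ) :
    cov[vol H ε F W t, vol H ε F W t'; P]
      = pairMean F (sigmaOU H σH) (fouCov H σH ((t' - t) / ε) / sigmaOU H σH ^ 2)
        - avg (sigmaOU H σH) F 1 ^ 2 := by
  have hL := hW.memLp_vol hH hH1 hF hε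
  rw [covariance_eq_sub (hL t) (hL t'), hW.integral_vol hH hH1 hσ hF hε,
    hW.integral_vol hH hH1 hσ hF hε, ← hW.integral_vol_mul_vol hH hH1 hσ hF hε, sq]
  rfl

lemma IsFBM.variance_vol (hW : IsFBM P H σH W) (hH : 0 < H) (hH1 : H < 1) (hσ : 0 < σH)
    (hF : IsVolFunction F) (hε : 0 < ε) (t : ℝ) :
    Var[vol H ε F W t; P] = avg (sigmaOU H σH) F 2 - avg (sigmaOU H σH) F 1 ^ 2 := by
  have hs := sigmaOU_pos hH hσ
  rw [← covariance_self (hW.memLp_vol hH hH1 hF hε t).1.aemeasurable,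
    hW.covariance_vol hH hH1 hσ hF hε, sub_self, zero_div, fouCov_zero hH, div_self (by positivity),
    pairMean_one]

lemma IsFBM.isStationary_vol (hW : IsFBM P H σH W) (hH : 0 < H) (hH1 : H < 1)
    (hF : IsVolFunction F) (hε : 0 < ε) : IsStationary (vol H ε F W) P := by
  intro h I
  have hm : Measurable fun (x : I → ℝ) i => F (x i) := by
    have := hF.continuous
    fun_prop
  exact (hW.identDistrib_fOU hH hH1 hε h I).comp hm

end Laws

/-! ### Asymptotics and non-integrability of the correlation -/

/-- The correlation function of the volatility process at unit scale. -/
noncomputable def volCorr (H σH : ℝ) (F : ℝ → ℝ) (τ : ℝ) : ℝ :=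
  (pairMean F (sigmaOU H σH) (fouCov H σH τ / sigmaOU H σH ^ 2) - avg (sigmaOU H σH) F 1 ^ 2)
    / (avg (sigmaOU H σH) F 2 - avg (sigmaOU H σH) F 1 ^ 2)

/-- The constant of the power-law decay of `volCorr`. -/
noncomputable def volCorrConst (H σH : ℝ) (F : ℝ → ℝ) : ℝ :=
  1 / Real.Gamma (2 * H - 1) * (sigmaOU H σH ^ 2 * avg (sigmaOU H σH) (deriv F) 1 ^ 2
    / (avg (sigmaOU H σH) F 2 - avg (sigmaOU H σH) F 1 ^ 2))

variable {H σH : ℝ} {F : ℝ → ℝ}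

lemma volCorrConst_pos (hH : 1 / 2 < H) (hσ : 0 < σH) (hF : IsVolFunction F) :
    0 < volCorrConst H σH F := by
  have hs := sigmaOU_pos (by linarith : 0 < H) hσ
  have h1 := hF.variance_pos hs.ne'
  have h2 := hF.avg_deriv_ne_zero hs
  have h3 := Real.Gamma_pos_of_pos (by linarith : 0 < 2 * H - 1)
  rw [volCorrConst]
  positivity

/-- First-order expansion of `pairMean` at `0`, evaluated at `ρ τ → 0`. As `ρ` is `O(τ^(2H-2))`, the
remainder `o(ρ)` is negligible at the required order. -/
lemma isLittleO_volCorr (hH : 1 / 2 < H) (hH1 : H < 1) (hσ : 0 < σH) (hF : IsVolFunction F) :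
    (fun τ : ℝ => volCorr H σH F τ - volCorrConst H σH F * τ ^ (2 * H - 2))
      =o[atTop] fun τ : ℝ => τ ^ (2 * H - 2) := by
  have hH0 : 0 < H := by linarith
  have hs := sigmaOU_pos hH0 hσ
  set s := sigmaOU H σH with hsdef
  set V := avg s F 2 - avg s F 1 ^ 2 with hV
  set D := s ^ 2 * avg s (deriv F) 1 ^ 2 with hD
  have hV0 : 0 < V := hF.variance_pos hs.ne'
  set ρ : ℝ → ℝ := fun τ => fouCov H σH τ / s ^ 2 with hρ
  set c : ℝ := H * (2 * H - 1) * σH ^ 2 / s ^ 2 with hc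
  have hlim : Tendsto (fun τ : ℝ => ρ τ / τ ^ (2 * H - 2)) atTop (𝓝 c) := by
    refine ((tendsto_rpow_mul_fouCov hH0 hH1 σH).div_const (s ^ 2)).congr' ?_
    filter_upwards [eventually_gt_atTop 0] with τ hτ
    rw [show 2 - 2 * H = -(2 * H - 2) by ring, Real.rpow_neg hτ.le, hρ]
    field_simp
  have hne : ∀ᶠ τ : ℝ in atTop, τ ^ (2 * H - 2) ≠ 0 := by
    filter_upwards [eventually_gt_atTop 0] with τ hτ
    exact (Real.rpow_pos_of_pos hτ _).ne'
  have hsmall : (fun τ => ρ τ - c * τ ^ (2 * H - 2)) =o[atTop] fun τ : ℝ => τ ^ (2 * H - 2) := by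
    rw [isLittleO_iff_tendsto' (hne.mono fun τ h h0 => absurd h0 h)]
    have := hlim.sub_const c
    rw [sub_self] at this
    refine this.congr' ?_
    filter_upwards [hne] with τ h
    rw [sub_div, mul_div_cancel_right₀ _ h]
  have hbig : ρ =O[atTop] fun τ : ℝ => τ ^ (2 * H - 2) := by
    have h := hsmall.isBigO.add ((isBigO_refl (fun τ : ℝ => τ ^ (2 * H - 2)) atTop).const_mul_left c)
    simpa using h
  have hρ0 : Tendsto ρ atTop (𝓝 0) := by
    have h := tendsto_rpow_neg_atTop (by linarith : 0 < 2 - 2 * H)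
    rw [show -(2 - 2 * H) = 2 * H - 2 by ring] at h
    exact hbig.trans_tendsto h
  have hder := (hasDerivAt_iff_isLittleO.1 (hF.hasDerivAt_pairMean s)).comp_tendsto hρ0
  have hder' : (fun τ => pairMean F s (ρ τ) - avg s F 1 ^ 2 - ρ τ * D)
      =o[atTop] fun τ : ℝ => τ ^ (2 * H - 2) := by
    refine IsLittleO.trans_isBigO ?_ hbig
    simpa [Function.comp_def, pairMean_zero] using hder
  have hK : volCorrConst H σH F = D * c / V := by
    -- Two steps of the Gamma recursion give `s² / Γ(2H - 1) = H (2H - 1) σH²`, matching the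
    -- constant of `tendsto_rpow_mul_fouCov` with the stated one.
    have hΓ : Real.Gamma (2 * H + 1) = 2 * H * ((2 * H - 1) * Real.Gamma (2 * H - 1)) := by
      rw [Real.Gamma_add_one (by linarith), ← Real.Gamma_add_one (s := 2 * H - 1) (by linarith)]
      ring_nf
    have hpos := Real.Gamma_pos_of_pos (by linarith : 0 < 2 * H - 1)
    have hsq := sigmaOU_sq hH0 σH
    rw [← hsdef, hΓ] at hsq
    have hDc : D * c = avg s (deriv F) 1 ^ 2 * (H * (2 * H - 1) * σH ^ 2) := by
      rw [hD, hc]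
      field_simp
    have hs2 : s ^ 2 / Real.Gamma (2 * H - 1) = H * (2 * H - 1) * σH ^ 2 := by
      rw [hsq]
      field_simp
    rw [hDc, ← hs2, volCorrConst]
    ring
  have htot := (hder'.add (hsmall.const_mul_left D)).const_mul_left V⁻¹
  refine htot.congr_left fun τ => ?_
  rw [hK, volCorr, ← hsdef, ← hV]
  simp only [hρ]
  ring

/-- Eventually the correlation exceeds half its leading term `K τ^(2H-2)`, with `K > 0`, and the
exponent is greater than `-1`. -/
lemma lintegral_volCorr_eq_top (hH : 1 / 2 < H) (hH1 : H < 1) (hσ : 0 < σH) (hF : IsVolFunction F)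
    {ε : ℝ} (hε : 0 < ε) (a : ℝ) :
    ∫⁻ s in Ioi a, ENNReal.ofReal |volCorr H σH F (s / ε)| = ⊤ := by
  set K := volCorrConst H σH F with hKdef
  have hK : 0 < K := volCorrConst_pos hH hσ hF
  have hev : ∀ᶠ τ : ℝ in atTop, K / 2 * τ ^ (2 * H - 2) ≤ |volCorr H σH F τ| := by
    filter_upwards [(isLittleO_volCorr hH hH1 hσ hF).bound (half_pos hK), eventually_gt_atTop 0]
      with τ h hτ
    have hp : 0 < τ ^ (2 * H - 2) := Real.rpow_pos_of_pos hτ _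
    rw [Real.norm_eq_abs, Real.norm_of_nonneg hp.le] at h
    linarith [(abs_le.1 h).1, le_abs_self (volCorr H σH F τ)]
  have hev' : ∀ᶠ s : ℝ in atTop, K / 2 * (s / ε) ^ (2 * H - 2) ≤ |volCorr H σH F (s / ε)| :=
    (tendsto_id.atTop_div_const hε).eventually hev
  obtain ⟨b, hb⟩ := eventually_atTop.1 hev'
  -- Beyond `m` a point lies in the domain of integration, past the threshold `b`, and is positive,
  -- as the power functions require.
  set m := max (max a b) 1 with hm
  have hm0 : 0 < m := lt_of_lt_of_le one_pos (le_max_right _ _)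
  refine top_unique ?_
  have hnot : ¬ IntegrableOn (fun s : ℝ => s ^ (2 * H - 2)) (Ioi m) := by
    rw [integrableOn_Ioi_rpow_iff hm0]
    linarith
  have hcst : ∀ s ∈ Ioi m, K / 2 * (s / ε) ^ (2 * H - 2)
      = K / 2 / ε ^ (2 * H - 2) * s ^ (2 * H - 2) := by
    intro s hs
    rw [Real.div_rpow (hm0.trans hs).le hε.le]
    ring
  have hC : 0 < K / 2 / ε ^ (2 * H - 2) := by positivity
  have htop : ∫⁻ s in Ioi m, ENNReal.ofReal (K / 2 / ε ^ (2 * H - 2) * s ^ (2 * H - 2)) = ⊤ := by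
    by_contra hne
    refine hnot ?_
    have hi : IntegrableOn (fun s : ℝ => K / 2 / ε ^ (2 * H - 2) * s ^ (2 * H - 2)) (Ioi m) := by
      refine (lintegral_ofReal_ne_top_iff_integrable
        (Measurable.aestronglyMeasurable (by fun_prop)) ?_).1 hne
      filter_upwards [ae_restrict_mem measurableSet_Ioi] with s hs
      have : 0 < s := hm0.trans hs
      positivity
    refine (hi.const_mul (K / 2 / ε ^ (2 * H - 2))⁻¹).congr (ae_of_all _ fun s => ?_)
    simp only
    rw [inv_mul_cancel_left₀ hC.ne']
  rw [← htop]
  calc _ ≤ ∫⁻ s in Ioi m, ENNReal.ofReal |volCorr H σH F (s / ε)| := by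
        refine setLIntegral_mono' measurableSet_Ioi fun s hs => ENNReal.ofReal_le_ofReal ?_
        rw [← hcst s hs]
        exact hb s ((le_max_right a b).trans ((le_max_left _ _).trans (mem_Ioi.1 hs).le))
    _ ≤ _ := lintegral_mono_set (Ioi_subset_Ioi ((le_max_left a b).trans (le_max_left _ _)))

end

end

end FOU

theorem lemma3p1 (H : ℝ) (hH : 1 / 2 < H) (hH1 : H < 1) (σH : ℝ) (hσH : 0 < σH)
    (F : ℝ → ℝ) (hF : FOU.IsVolFunction F) :
    0 < FOU.avg (FOU.sigmaOU H σH) F 2 - FOU.avg (FOU.sigmaOU H σH) F 1 ^ 2 ∧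
    ∃ Cσ : ℝ → ℝ,
      Cσ 0 = 1 ∧
      (fun s : ℝ => Cσ s
          - 1 / Real.Gamma (2 * H - 1)
            * (FOU.sigmaOU H σH ^ 2 * FOU.avg (FOU.sigmaOU H σH) (deriv F) 1 ^ 2
              / (FOU.avg (FOU.sigmaOU H σH) F 2 - FOU.avg (FOU.sigmaOU H σH) F 1 ^ 2))
            * s ^ (2 * H - 2))
        =o[atTop] (fun s : ℝ => s ^ (2 * H - 2)) ∧
      ∀ (Ω : Type*) [MeasurableSpace Ω] (P : Measure Ω) [IsProbabilityMeasure P]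
        (W : ℝ → Ω → ℝ), FOU.IsFBM P H σH W → ∀ ε : ℝ, 0 < ε →
        FOU.IsStationary (FOU.vol H ε F W) P ∧
        (∀ t, MemLp (FOU.vol H ε F W t) 2 P ∧
          ∫ ω, FOU.vol H ε F W t ω ∂P = FOU.avg (FOU.sigmaOU H σH) F 1 ∧
          Var[FOU.vol H ε F W t; P]
            = FOU.avg (FOU.sigmaOU H σH) F 2 - FOU.avg (FOU.sigmaOU H σH) F 1 ^ 2) ∧
        (∀ t s, cov[FOU.vol H ε F W t, FOU.vol H ε F W (t + s); P]
            = (FOU.avg (FOU.sigmaOU H σH) F 2 - FOU.avg (FOU.sigmaOU H σH) F 1 ^ 2)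
              * Cσ (s / ε)) ∧
        FOU.HasLongRangeCorrelations (FOU.vol H ε F W) P := by
  have hH0 : 0 < H := by linarith
  have hs := FOU.sigmaOU_pos hH0 hσH
  have hV := hF.variance_pos hs.ne'
  refine ⟨hV, FOU.volCorr H σH F, ?_, FOU.isLittleO_volCorr hH hH1 hσH hF, ?_⟩
  · rw [FOU.volCorr, FOU.fouCov_zero hH0, div_self (by positivity), FOU.pairMean_one,
      div_self hV.ne']
  intro Ω _ P _ W hW ε hε
  have hcov : ∀ t s, cov[FOU.vol H ε F W t, FOU.vol H ε F W (t + s); P]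
      = (FOU.avg (FOU.sigmaOU H σH) F 2 - FOU.avg (FOU.sigmaOU H σH) F 1 ^ 2)
        * FOU.volCorr H σH F (s / ε) := by
    intro t s
    rw [hW.covariance_vol hH0 hH1 hσH hF hε, add_sub_cancel_left, FOU.volCorr,
      mul_div_cancel₀ _ hV.ne']
  have hvar := hW.variance_vol hH0 hH1 hσH hF hε
  refine ⟨hW.isStationary_vol hH0 hH1 hF hε, fun t => ⟨hW.memLp_vol hH0 hH1 hF hε t,
    hW.integral_vol hH0 hH1 hσH hF hε t, hvar t⟩, hcov, fun t a => ?_⟩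
  -- Both variances equal the same positive constant, so the correlation coefficient is exactly
  -- `volCorr` at `s / ε`.
  simp_rw [hcov, hvar, Real.sqrt_mul_self hV.le, mul_div_cancel_left₀ _ hV.ne']
  exact FOU.lintegral_volCorr_eq_top hH hH1 hσH hF hε a
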